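/- Let $n\ge 2$. Let $\mathrm{Pol}^-_n$ be the ring generated by $x_1,\dots,x_n$ subject to $x_ix_j+x_jx_i=0$ for $i\ne j$. The type D odd Demazure operators $\partial_1,\dots,\partial_n$ are the additive endomorphisms of $\mathrm{Pol}^-_n$ that satisfy $\partial_i(1)=0$ and the twisted Leibniz rule $\partial_i(fg)=\partial_i(f)\,g+s_i(f)\,\partial_i(g)$, where: - for $1\le i\le n-1$: $\partial_i(x_i)=\partial_i(x_{i+1})=1$ and $\partial_i(x_j)=0$ for $j\neq i,i+1$, and $s_i$ is the ring endomorphism with $s_i(x_i)=-x_{i+1}$, $s_i(x_{i+1})=-x_i$ and $s_i(x_j)=-x_j$ for $j\ne i,i+1$; - $\partial_n(x_{n-1})=1$, $\partial_n(x_n)=-1$ and $\partial_n(x_j)=0$ for $j\le n-2$, and $s_n$ is the ring endomorphism with $s_n(x_{n-1})=x_n$, $s_n(x_n)=x_{n-1}$ and $s_n(x_j)=-x_j$ for $j\le n-2$. Let $\Lambda_n=\bigcap_{i=1}^n\ker\partial_i$, a subring of $\mathrm{Pol}^-_n$ (the ring of spin type D symmetric polynomials). The spin type D nilHecke algebra $\mathrm{NH}_n$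 is the unital ring generated by $x_1,\dots,x_n,\partial_1,\dots,\partial_n$ subject to the following relations. For the $x_i$: $x_ix_j+x_jx_i=0$ for $i\neq j$. For $1\le i,j\le n-1$: $\partial_i^2=0$; $\partial_i\partial_{i+1}\partial_i=\partial_{i+1}\partial_i\partial_{i+1}$ if $i\le n-2$; $\partial_i\partial_j+\partial_j\partial_i=0$ if $|i-j|>1$; $x_i\partial_i+\partial_ix_{i+1}=1$ and $\partial_ix_i+x_{i+1}\partial_i=1$; and $\partial_ix_k+x_k\partial_i=0$ for $1\le k\le n$, $k\ne i,i+1$. For $\partial_n$: $\partial_n^2=0$; $\partial_n\partial_{n-2}\partial_n=\partial_{n-2}\partial_n\partial_{n-2}$ (if $n\ge 3$); $\partial_n\partial_i+\partial_i\partial_n=0$ for $i\le n-3$; $\partial_n\partial_{n-1}-\partial_{n-1}\partial_n=0$; $x_{n-1}\partial_n-\partial_nx_n=1$ and $\partial_nx_{n-1}-x_n\partial_n=1$; and $\partial_nx_i+x_i\partial_n=0$ for $i\le n-2$. Grade these rings by $|x_i|=2$ and $|\partial_i|=-2$. Let the subscript $\mathbb Q$ denote base change $\mathbb Q\otimes_{\mathbb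 Z}(-)$, and regard $\mathrm{Pol}^-_{n,\mathbb Q}$ as a right $\Lambda_{n,\mathbb Q}$-module by right multiplication. **Theorem.** Letting the generators $x_i$ act on $\mathrm{Pol}^-_{n,\mathbb Q}$ by left multiplication and the generators $\partial_i$ by the odd Demazure operators defines an isomorphism of graded $\mathbb Q$-algebras $$\mathrm{NH}_{n,\mathbb Q}\xrightarrow{\ \cong\ }\mathrm{End}_{\Lambda_{n,\mathbb Q}}(\mathrm{Pol}^-_{n,\mathbb Q}).$$ Moreover there is an isomorphism of graded $\mathbb Q$-algebras $$\mathrm{End}_{\Lambda_{n,\mathbb Q}}(\mathrm{Pol}^-_{n,\mathbb Q})\cong \mathrm{Mat}_{q^{n(n-1)}[n][2n-2]!!}(\Lambda_{n,\mathbb Q}).$$ Here $[m]=\frac{q^m-q^{-m}}{q-q^{-1}}$ and $[2m]!!=[2m][2m-2]\cdots[4][2]$. The right-hand side denotes the algebra of matrices over $\Lambda_{n,\mathbb Q}$ whose rows and columns are indexed by the Weyl group $D_n$ of even signed permutations. It is graded by means of integers $(e_w)_{w\in D_n}$ with $\sum_{w\in D_n}q^{e_w}=q^{n(n-1)}[n][2n-2]!!$: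 the matrix unit in position $(v,w)$ has degree $e_v-e_w$. In particular, the matrices have size $|D_n|=2^{n-1}n!$. -/

import Mathlib

open scoped TensorProduct

namespace SpinNilHeckeD

noncomputable section

/-! ### The skew-polynomial ring -/

/-- The defining relations `x_i x_j + x_j x_i = 0` (`i ≠ j`) of the skew-polynomial ring. -/
inductive SkewRel (n : ℕ) : FreeAlgebra ℤ (Fin n) → FreeAlgebra ℤ (Fin n) → Prop
  | anti (i j : Fin n) (h : i ≠ j) :
      SkewRel n (FreeAlgebra.ι ℤ i * FreeAlgebra.ι ℤ j + FreeAlgebra.ι ℤ j * FreeAlgebra.ι ℤ i) 0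

/-- The skew-polynomial ring `Pol⁻_n`: the ring generated by `x_0, …, x_{n-1}` subject to
`x_i x_j + x_j x_i = 0` for `i ≠ j`. (All indices are shifted by one, so that they start at `0`.) -/
def Pol (n : ℕ) : Type := RingQuot (SkewRel n)

instance (n : ℕ) : Ring (Pol n) := inferInstanceAs (Ring (RingQuot (SkewRel n)))

namespace Pol

/-- The quotient map from the free ring. -/
def mk (n : ℕ) : FreeAlgebra ℤ (Fin n) →+* Pol n := RingQuot.mkRingHom (SkewRel n)

/-- The variable `x_i`. -/
def X {n : ℕ} (i : Fin n) : Pol n := mk n (FreeAlgebra.ι ℤ i)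

theorem anti {n : ℕ} {i j : Fin n} (h : i ≠ j) : (X i : Pol n) * X j + X j * X i = 0 := by
  have := RingQuot.mkRingHom_rel (SkewRel.anti i j h)
  rw [map_add, map_mul, map_mul, map_zero] at this
  exact this

/-- The universal property: a family of anticommuting elements of a ring defines a ring homomorphism
out of the skew-polynomial ring. -/
def lift {n : ℕ} {A : Type} [Ring A] (f : Fin n → A)
    (hf : ∀ i j, i ≠ j → f i * f j + f j * f i = 0) : Pol n →+* A :=
  RingQuot.lift ⟨(FreeAlgebra.lift ℤ f).toRingHom, by
    rintro _ _ ⟨i, j, h⟩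
    simpa using hf i j h⟩

@[simp] theorem lift_X {n : ℕ} {A : Type} [Ring A] (f : Fin n → A)
    (hf : ∀ i j, i ≠ j → f i * f j + f j * f i = 0) (i : Fin n) : lift f hf (X i) = f i := by
  have := RingQuot.lift_mkRingHom_apply (FreeAlgebra.lift ℤ f).toRingHom (r := SkewRel n)
    (by rintro _ _ ⟨i, j, h⟩; simpa using hf i j h) (FreeAlgebra.ι ℤ i)
  exact this.trans (by simp)

theorem induction {n : ℕ} {p : Pol n → Prop} (hX : ∀ i, p (X i)) (h1 : p 1)
    (hneg : ∀ f, p f → p (-f)) (hadd : ∀ f g, p f → p g → p (f + g))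
    (hmul : ∀ f g, p f → p g → p (f * g)) (f : Pol n) : p f := by
  obtain ⟨a, rfl⟩ := RingQuot.mkRingHom_surjective (SkewRel n) f
  have h0 : p 0 := by simpa using hadd _ _ h1 (hneg _ h1)
  change p (mk n a)
  induction a using FreeAlgebra.induction with
  | grade0 r =>
    rw [eq_intCast (algebraMap ℤ (FreeAlgebra ℤ (Fin n))) r, map_intCast]
    induction r using Int.induction_on with
    | zero => simpa using h0
    | succ k ih => rw [Int.cast_add, Int.cast_one]; exact hadd _ _ ih h1
    | pred k ih => rw [Int.cast_sub, Int.cast_one, sub_eq_add_neg]; exact hadd _ _ ih (hneg _ h1)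
  | grade1 i => exact hX i
  | mul a b ha hb => rw [map_mul]; exact hmul _ _ ha hb
  | add a b ha hb => rw [map_add]; exact hadd _ _ ha hb

end Pol

/-! ### Odd Demazure operators

Both kinds of operators have the same shape, for a pair of indices `(a, b)` and a sign `ε`: the
twist `s` sends `x_a` to `-ε x_b`, `x_b` to `-ε x_a` and every other `x_j` to `-x_j`, and the
operator `∂` sends `x_a` to `1`, `x_b` to `ε` and every other `x_j` to `0`. The sign is `1` for the
type A operators, and `-1` for the last type D operator. -/

section General

variable {n : ℕ} (a b : Fin n) (ε : ℤˣ)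

/-- The sign in `s(x_j)`. -/
def twistSign (j : Fin n) : ℤ := if j = a ∨ j = b then -(ε : ℤ) else -1

/-- The values `s(x_j)`: `-ε x_b` for `j = a`, `-ε x_a` for `j = b`, and `-x_j` otherwise. -/
def twistX (j : Fin n) : Pol n := twistSign a b ε j • Pol.X (Equiv.swap a b j)

/-- The values `∂(x_j)`: `1` for `j = a`, `ε` for `j = b`, and `0` otherwise. -/
def demX (j : Fin n) : ℤ := if j = a then 1 else if j = b then (ε : ℤ) else 0

theorem twistX_anti (i j : Fin n) (h : i ≠ j) :
    twistX a b ε i * twistX a b ε j + twistX a b ε j * twistX a b ε i = 0 := by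
  have H := Pol.anti (n := n) ((Equiv.swap a b).injective.ne h)
  simp only [twistX, smul_mul_smul_comm]
  rw [mul_comm (twistSign a b ε j), ← smul_add, H, smul_zero]

theorem demX_anti (i j : Fin n) (h : i ≠ j) :
    (twistX a b ε i * (demX a b ε j : Pol n) + (demX a b ε i : Pol n) * Pol.X j) +
      (twistX a b ε j * (demX a b ε i : Pol n) + (demX a b ε j : Pol n) * Pol.X i) = 0 := by
  unfold twistX demX twistSign
  rcases Int.units_eq_one_or ε with rfl | rfl <;>
  · by_cases h1 : i = a <;> by_cases h2 : j = a <;> by_cases h3 : i = b <;> by_cases h4 : j = b <;>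
      simp_all [Equiv.swap_apply_of_ne_of_ne]

/-- The ring homomorphism `s`. -/
def twist : Pol n →+* Pol n := Pol.lift (twistX a b ε) (twistX_anti a b ε)

/-- The ring homomorphism `f ↦ !![s f, ∂ f; 0, f]`, whose multiplicativity encodes the twisted
Leibniz rule `∂(f g) = ∂(f) g + s(f) ∂(g)`. -/
def demMatrix : Pol n →+* Matrix (Fin 2) (Fin 2) (Pol n) :=
  Pol.lift (fun j => !![twistX a b ε j, (demX a b ε j : Pol n); 0, Pol.X j]) (by
    intro i j h
    have h1 := twistX_anti a b ε i j h
    have h2 := demX_anti a b ε i j h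
    have h3 := Pol.anti h
    ext k l
    fin_cases k <;> fin_cases l <;> simp [h1, h2, h3])

/-- The odd Demazure operator `∂` of the pair `(a, b)` and the sign `ε`. It is the additive map
determined by its values on the variables and on `1` and by the twisted Leibniz rule: see
`oddDem_one`, `oddDem_X` and `oddDem_mul`. -/
def oddDem : Pol n →ₗ[ℤ] Pol n where
  toFun f := demMatrix a b ε f 0 1
  map_add' f g := by simp
  map_smul' m f := by rw [map_zsmul]; rfl

theorem demMatrix_diag (f : Pol n) :
    demMatrix a b ε f 0 0 = twist a b ε f ∧ demMatrix a b ε f 1 0 = 0 ∧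
      demMatrix a b ε f 1 1 = f := by
  induction f using Pol.induction with
  | hX i => simp [demMatrix, twist]
  | h1 => simp
  | hneg f hf => simp [hf]
  | hadd f g hf hg => simp [hf, hg]
  | hmul f g hf hg => simp [Matrix.mul_apply, Fin.sum_univ_two, hf, hg]

@[simp] theorem twist_X (j : Fin n) : twist a b ε (Pol.X j) = twistX a b ε j := by
  simp [twist]

@[simp] theorem oddDem_one : oddDem a b ε 1 = 0 := by
  simp [oddDem]

@[simp] theorem oddDem_X (j : Fin n) : oddDem a b ε (Pol.X j) = (demX a b ε j : Pol n) := by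
  simp [oddDem, demMatrix]

theorem oddDem_mul (f g : Pol n) :
    oddDem a b ε (f * g) = oddDem a b ε f * g + twist a b ε f * oddDem a b ε g := by
  have h := demMatrix_diag a b ε
  simp only [oddDem, LinearMap.coe_mk, AddHom.coe_mk, map_mul, Matrix.mul_apply,
    Fin.sum_univ_two, (h f).1, (h g).2.2]
  rw [add_comm]

end General

/-- The type D odd Demazure operators. For `i + 1 < n` this is the type A operator of the pair
`(i, i + 1)`: it sends `x_i` and `x_{i+1}` to `1`, and its twist exchanges `x_i` and `x_{i+1}` up to
the sign `-1`. For the last index `i = n - 1` it is the operator of the pair `(n - 2, n - 1)` that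
sends `x_{n-2}` to `1` and `x_{n-1}` to `-1`, and its twist exchanges `x_{n-2}` and `x_{n-1}`
without a sign. In all cases the twist sends the other variables to their negatives. -/
def dem {n : ℕ} (i : Fin n) : Pol n →ₗ[ℤ] Pol n :=
  if h : (i : ℕ) + 1 < n then oddDem i ⟨i + 1, h⟩ 1
  else oddDem ⟨i - 1, lt_of_le_of_lt (Nat.sub_le _ _) i.isLt⟩ i (-1)

/-- The twisted Leibniz rule for the type D operators, for some ring endomorphism. -/
theorem exists_dem_mul {n : ℕ} (i : Fin n) :
    ∃ s : Pol n →+* Pol n, ∀ f g, dem i (f * g) = dem i f * g + s f * dem i g := by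
  unfold dem
  split_ifs with h
  · exact ⟨_, oddDem_mul _ _ _⟩
  · exact ⟨_, oddDem_mul _ _ _⟩

/-- The ring `Λ_n` of spin type D symmetric polynomials: the common kernel of the type D odd
Demazure operators. -/
def Lam (n : ℕ) : Subring (Pol n) where
  carrier := {f | ∀ i, dem i f = 0}
  mul_mem' {f g} hf hg i := by
    obtain ⟨s, hs⟩ := exists_dem_mul i
    rw [hs, hf i, hg i, zero_mul, mul_zero, add_zero]
  one_mem' i := by
    unfold dem
    split_ifs with h <;> simp
  add_mem' {f g} hf hg i := by rw [map_add, hf i, hg i, add_zero]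
  zero_mem' i := map_zero _
  neg_mem' {f} hf i := by rw [map_neg, hf i, neg_zero]

/-! ### The spin type D nilHecke algebra -/

/-- The generators: `x i` is the variable `x_i`, and `d i` is the nilCoxeter generator `∂_i`, the
last of which (`i = n - 1`) is the additional type D generator. -/
inductive Gen (n : ℕ) : Type
  | x (i : Fin n) : Gen n
  | d (i : Fin n) : Gen n

/-- The variable `x_i` in the free ring. -/
def fx {n : ℕ} (i : Fin n) : FreeAlgebra ℤ (Gen n) := FreeAlgebra.ι ℤ (Gen.x i)

/-- The generator `∂_i` in the free ring. -/
def fd {n : ℕ} (i : Fin n) : FreeAlgebra ℤ (Gen n) := FreeAlgebra.ι ℤ (Gen.d i)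

/-- The defining relations of the spin type D nilHecke algebra. In the relations whose name ends in
`D` the index `l` is the last one, `l = n - 1`. -/
inductive NHRel (n : ℕ) : FreeAlgebra ℤ (Gen n) → FreeAlgebra ℤ (Gen n) → Prop
  | anti (i j : Fin n) (h : i ≠ j) : NHRel n (fx i * fx j + fx j * fx i) 0
  | sq (i : Fin n) (hi : (i : ℕ) + 1 < n) : NHRel n (fd i ^ 2) 0
  | braid (i j : Fin n) (hij : (i : ℕ) + 1 = j) (hj : (j : ℕ) + 1 < n) :
      NHRel n (fd i * fd j * fd i) (fd j * fd i * fd j)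
  | far (i j : Fin n) (hi : (i : ℕ) + 1 < n) (hj : (j : ℕ) + 1 < n)
      (hij : (i : ℕ) + 1 < j ∨ (j : ℕ) + 1 < i) : NHRel n (fd i * fd j + fd j * fd i) 0
  | xd (i j : Fin n) (hij : (i : ℕ) + 1 = j) : NHRel n (fx i * fd i + fd i * fx j) 1
  | dx (i j : Fin n) (hij : (i : ℕ) + 1 = j) : NHRel n (fd i * fx i + fx j * fd i) 1
  | dxFar (i j : Fin n) (hi : (i : ℕ) + 1 < n) (h : j ≠ i) (h' : (j : ℕ) ≠ i + 1) :
      NHRel n (fd i * fx j + fx j * fd i) 0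
  | sqD (l : Fin n) (hl : (l : ℕ) + 1 = n) : NHRel n (fd l ^ 2) 0
  | braidD (k l : Fin n) (hl : (l : ℕ) + 1 = n) (hk : (k : ℕ) + 2 = l) :
      NHRel n (fd l * fd k * fd l) (fd k * fd l * fd k)
  | farD (i l : Fin n) (hl : (l : ℕ) + 1 = n) (hi : (i : ℕ) + 2 < l) :
      NHRel n (fd l * fd i + fd i * fd l) 0
  | commD (k l : Fin n) (hl : (l : ℕ) + 1 = n) (hk : (k : ℕ) + 1 = l) :
      NHRel n (fd l * fd k - fd k * fd l) 0
  | xdD (k l : Fin n) (hl : (l : ℕ) + 1 = n) (hk : (k : ℕ) + 1 = l) :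
      NHRel n (fx k * fd l - fd l * fx l) 1
  | dxD (k l : Fin n) (hl : (l : ℕ) + 1 = n) (hk : (k : ℕ) + 1 = l) :
      NHRel n (fd l * fx k - fx l * fd l) 1
  | dxFarD (i l : Fin n) (hl : (l : ℕ) + 1 = n) (hi : (i : ℕ) + 1 < l) :
      NHRel n (fd l * fx i + fx i * fd l) 0

/-- The spin type D nilHecke algebra `NH_n` over `ℤ`. -/
def NH (n : ℕ) : Type := RingQuot (NHRel n)

instance (n : ℕ) : Ring (NH n) := inferInstanceAs (Ring (RingQuot (NHRel n)))

namespace NH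

/-- The quotient map from the free ring. -/
def mk (n : ℕ) : FreeAlgebra ℤ (Gen n) →+* NH n := RingQuot.mkRingHom (NHRel n)

/-- The images of the generators. -/
def gen {n : ℕ} (g : Gen n) : NH n := mk n (FreeAlgebra.ι ℤ g)

end NH

/-! ### Base change to `ℚ` -/

/-- `Pol⁻_{n,ℚ}`. -/
abbrev PolQ (n : ℕ) : Type := ℚ ⊗[ℤ] Pol n

/-- `Λ_{n,ℚ}`. -/
abbrev LamQ (n : ℕ) : Type := ℚ ⊗[ℤ] Lam n

/-- `NH_{n,ℚ}`. -/
abbrev NHQ (n : ℕ) : Type := ℚ ⊗[ℤ] NH n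

/-- The base change `Λ_{n,ℚ} → Pol⁻_{n,ℚ}` of the inclusion. -/
def incl (n : ℕ) : LamQ n →ₐ[ℚ] PolQ n :=
  Algebra.TensorProduct.map (AlgHom.id ℚ ℚ) (Lam n).subtype.toIntAlgHom

/-- `Pol⁻_{n,ℚ}` as a right module over `Λ_{n,ℚ}`, by right multiplication. -/
instance (n : ℕ) : Module (LamQ n)ᵐᵒᵖ (PolQ n) :=
  Module.compHom (PolQ n) ((incl n).toRingHom.op)

theorem op_smul_eq {n : ℕ} (g : LamQ n) (f : PolQ n) : MulOpposite.op g • f = f * incl n g := rfl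

instance (n : ℕ) : SMulCommClass (LamQ n)ᵐᵒᵖ ℚ (PolQ n) where
  smul_comm g c f := by
    induction g using MulOpposite.rec' with
    | _ g => rw [op_smul_eq, op_smul_eq, smul_mul_assoc]

instance (n : ℕ) : IsScalarTower ℚ (LamQ n)ᵐᵒᵖ (PolQ n) where
  smul_assoc c g f := by
    induction g using MulOpposite.rec' with
    | _ g => rw [← MulOpposite.op_smul, op_smul_eq, op_smul_eq, map_smul, mul_smul_comm]

instance (n : ℕ) : SMulCommClass ℚ (LamQ n)ᵐᵒᵖ (PolQ n) := SMulCommClass.symm _ _ _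

/-- The algebra `End_{Λ_{n,ℚ}}(Pol⁻_{n,ℚ})` of endomorphisms of the right `Λ_{n,ℚ}`-module
`Pol⁻_{n,ℚ}`. -/
abbrev EndQ (n : ℕ) : Type := Module.End (LamQ n)ᵐᵒᵖ (PolQ n)

/-! ### Gradings -/

/-- The degree of a generator: `2` for the variables and `-2` for the `∂_i`. -/
def Gen.deg {n : ℕ} : Gen n → ℤ
  | .x _ => 2
  | .d _ => -2

/-- The part of degree `k` of `NH_{n,ℚ}`: the span of the words of degree `k` in the generators. -/
def NHQ.degree (n : ℕ) (k : ℤ) : Submodule ℚ (NHQ n) :=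
  Submodule.span ℚ
    {a | ∃ l : List (Gen n), (l.map Gen.deg).sum = k ∧ a = 1 ⊗ₜ[ℤ] (l.map NH.gen).prod}

/-- The part of degree `k` of `Pol⁻_{n,ℚ}`, where the variables have degree `2`. -/
def PolQ.degree (n : ℕ) (k : ℤ) : Submodule ℚ (PolQ n) :=
  Submodule.span ℚ
    {f | ∃ l : List (Fin n), 2 * (l.length : ℤ) = k ∧ f = 1 ⊗ₜ[ℤ] (l.map Pol.X).prod}

/-- The part of degree `k` of `Λ_{n,ℚ}`. -/
def LamQ.degree (n : ℕ) (k : ℤ) : Submodule ℚ (LamQ n) :=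
  (PolQ.degree n k).comap (incl n).toLinearMap

/-- The endomorphisms of degree `k`. -/
def EndQ.degree (n : ℕ) (k : ℤ) : Submodule ℚ (EndQ n) where
  carrier := {T | ∀ j, ∀ f ∈ PolQ.degree n j, T f ∈ PolQ.degree n (j + k)}
  add_mem' hS hT _ _ hf := add_mem (hS _ _ hf) (hT _ _ hf)
  zero_mem' _ _ _ := zero_mem _
  smul_mem' c _ hT _ _ hf := Submodule.smul_mem _ c (hT _ _ hf)

/-- The part of degree `k` of the matrix algebra over `Λ_{n,ℚ}` whose rows and columns are shifted
by `e`: the matrix unit at `(v, w)` has degree `e v - e w`. This is the matrix algebra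
`Mat_{p(q)}(Λ_{n,ℚ})` for `p(q) = ∑_w q ^ (e w)`. -/
def matrixDegree {n : ℕ} {I : Type} (e : I → ℤ) (k : ℤ) : Submodule ℚ (Matrix I I (LamQ n)) where
  carrier := {M | ∀ v w, M v w ∈ LamQ.degree n (k - (e v - e w))}
  add_mem' hM hN v w := add_mem (hM v w) (hN v w)
  zero_mem' _ _ := zero_mem _
  smul_mem' c _ hM v w := Submodule.smul_mem _ c (hM v w)

/-! ### The Weyl group and the graded size -/

/-- The Weyl group `D_n`, as the group of the permutations `w` of `{±1, …, ±n}` (here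
`Fin n × {±1}`) that satisfy `w(-a) = -w(a)` and send an even number of positive elements to
negative elements. -/
def WeylD (n : ℕ) : Subgroup (Equiv.Perm (Fin n × ℤˣ)) where
  carrier := {w | (∀ i ε, w (i, ε) = ((w (i, 1)).1, ε * (w (i, 1)).2)) ∧ ∏ i, (w (i, 1)).2 = 1}
  mul_mem' {w v} hw hv := by
    have hinj : Function.Injective fun i => (v (i, 1)).1 := by
      intro i j hij
      have h1 := hv.1 i (v (i, 1)).2
      have h2 := hv.1 j (v (j, 1)).2
      rw [Int.units_mul_self] at h1 h2
      have h3 := v.injective (h1.trans ((congrArg (fun k => (k, (1 : ℤˣ))) hij).trans h2.symm))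
      exact congrArg Prod.fst h3
    have key : ∀ i, (w * v) (i, 1) =
        ((w ((v (i, 1)).1, 1)).1, (v (i, 1)).2 * (w ((v (i, 1)).1, 1)).2) := fun i =>
      hw.1 (v (i, 1)).1 (v (i, 1)).2
    refine ⟨fun i ε => ?_, ?_⟩
    · rw [key, Equiv.Perm.mul_apply, hv.1, hw.1, mul_assoc]
    · simp only [key, Finset.prod_mul_distrib]
      rw [hv.2, one_mul]
      refine Eq.trans ?_ hw.2
      exact (Equiv.ofBijective _ (Finite.injective_iff_bijective.1 hinj)).prod_comp
        fun i => (w (i, 1)).2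
  one_mem' := by simp
  inv_mem' {w} hw := by
    have hodd : ∀ i ε, w⁻¹ (i, ε) = ((w⁻¹ (i, 1)).1, ε * (w⁻¹ (i, 1)).2) := by
      intro i ε
      rw [Equiv.Perm.inv_eq_iff_eq, hw.1, mul_assoc]
      have h := hw.1 (w⁻¹ (i, 1)).1 (w⁻¹ (i, 1)).2
      rw [Prod.mk.eta, show w (w⁻¹ (i, 1)) = (i, 1) from w.apply_symm_apply _] at h
      rw [Prod.mk.injEq] at h ⊢
      exact ⟨h.1, by rw [← h.2, mul_one]⟩
    have hinj : Function.Injective fun i => (w⁻¹ (i, 1)).1 := by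
      intro i j hij
      have h1 := hodd i (w⁻¹ (i, 1)).2
      have h2 := hodd j (w⁻¹ (j, 1)).2
      rw [Int.units_mul_self] at h1 h2
      have h3 := w⁻¹.injective (h1.trans ((congrArg (fun k => (k, (1 : ℤˣ))) hij).trans h2.symm))
      exact congrArg Prod.fst h3
    refine ⟨hodd, ?_⟩
    have h : ∀ i, (w⁻¹ (i, 1)).2 * (w ((w⁻¹ (i, 1)).1, 1)).2 = 1 := by
      intro i
      have h := hw.1 (w⁻¹ (i, 1)).1 (w⁻¹ (i, 1)).2
      rw [Prod.mk.eta, show w (w⁻¹ (i, 1)) = (i, 1) from w.apply_symm_apply _] at h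
      exact (congrArg Prod.snd h).symm
    have h' : ∏ i, (w ((w⁻¹ (i, 1)).1, 1)).2 = 1 := by
      refine Eq.trans ?_ hw.2
      exact (Equiv.ofBijective _ (Finite.injective_iff_bijective.1 hinj)).prod_comp
        fun i => (w (i, 1)).2
    have := Finset.prod_congr (rfl : (Finset.univ : Finset (Fin n)) = Finset.univ) fun i _ => h i
    rwa [Finset.prod_mul_distrib, h', mul_one, Finset.prod_const_one] at this

instance (n : ℕ) : Fintype (WeylD n) := Fintype.ofFinite _

open LaurentPolynomial in
/-- The quantum integer `[m] = (q^m - q^{-m}) / (q - q^{-1}) = q^{m-1} + q^{m-3} + ⋯ + q^{1-m}`, as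
a Laurent polynomial in `q`. -/
def qInt (m : ℕ) : LaurentPolynomial ℤ := ∑ i ∈ Finset.range m, T ((m : ℤ) - 1 - 2 * i)

open LaurentPolynomial in
theorem qInt_mul (m : ℕ) :
    qInt m * (T 1 - T (-1)) = (T (m : ℤ) - T (-(m : ℤ)) : LaurentPolynomial ℤ) := by
  have h : ∀ i : ℕ, (T ((m : ℤ) - 1 - 2 * i) * (T 1 - T (-1)) : LaurentPolynomial ℤ) =
      T ((m : ℤ) - 2 * i) - T ((m : ℤ) - 2 * (i + 1 : ℕ)) := by
    intro i
    rw [mul_sub, ← T_add, ← T_add]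
    congr 2
    · ring
    · push_cast
      ring
  rw [qInt, Finset.sum_mul, Finset.sum_congr rfl fun i _ => h i,
    Finset.sum_range_sub' fun i : ℕ => (T ((m : ℤ) - 2 * i) : LaurentPolynomial ℤ)]
  congr 2
  ring

/-- The quantum double factorial `[2m]!! = [2m][2m-2]⋯[4][2]`. -/
def qDoubleFactorial (m : ℕ) : LaurentPolynomial ℤ := ∏ k ∈ Finset.Icc 1 m, qInt (2 * k)

end

end SpinNilHeckeD

/-!
The proof exhibits a decomposition that every representation `M` of the nilHecke algebra over `ℚ`
has: there are monomials `u_w` in the variables, one for every element `w` of the Weyl group, such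
that every `m` in `M` is uniquely a sum of terms `u_w m_w`, where all `∂_j` kill every `m_w`.

* For the left regular representation and `m = 1` this writes `1 = ∑ u_w m_w` in the nilHecke
  algebra. An element `a` then equals `∑ a(u_w) m_w`, where `a(u_w)` is the result of the action of
  `a` on the skew polynomial `u_w`, because `∂_j p m_w = ∂_j(p) m_w` for every skew polynomial `p`.
  Hence the action is faithful. An endomorphism `T` over the symmetric polynomials is the action of
  `∑ T(u_w) m_w`, since `m_w` maps every skew polynomial to a symmetric one (`actHom_bijective`).
* For the polynomial representation it says that the `u_w` form a basis of the skew polynomials over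
  the symmetric ones, which gives the isomorphism with the matrix algebra
  (`exists_algEquiv_matrix`).

The decomposition is built along the tower of parabolic subgroups of types `D_1 ⊂ D_2 ⊂ ⋯ ⊂ D_n`,
where the trivial group stands for `D_1`. In the step from `D_{m}` to `D_{m+1}` the group `D_m` acts
on the last `m` variables, and the common kernel of its operators decomposes by means of the powers
`1, y, …, y^{2m}` of the new variable `y` and of the product of the last `m` variables
(`SpinAction.decomposes_step`). The summands are detected by the operators `∂_v` of the `2m + 2`
minimal coset representatives `v`: these operators, ordered by length, are triangular with respect
to the monomials. The two representatives of length `m` differ by the two end nodes of the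
Dynkin diagram, and they are replaced by their sum and their difference, which separate `y^m` from
the product of the other variables up to factors `2`. This is where rational coefficients are
needed.

That the operators act at all is the computation of the relations between the odd Demazure operators
(`lift_polOp_rel`): a relation `R = 0` is verified by showing `R(1) = 0` and `R x_k = y R` for some
skew polynomial `y` that depends on `k`.
-/

namespace SpinNilHeckeD

/-! ### Actions of the spin type D nilHecke algebra -/

/-- A rational vector space with operators `x_0, …, x_{N+1}` and `∂_0, …, ∂_{N+1}` that satisfy the
relations of the spin type D nilHecke algebra of rank `N + 2` that involve some `∂_i`. The operators
are indexed by all natural numbers, those of index above `N + 1` being irrelevant. -/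
structure SpinAction (N : ℕ) (M : Type) [AddCommGroup M] [Module ℚ M] where
  x : ℕ → M →ₗ[ℚ] M
  d : ℕ → M →ₗ[ℚ] M
  sq : ∀ i, i ≤ N + 1 → ∀ m, d i (d i m) = 0
  braid : ∀ i, i + 1 ≤ N → ∀ m, d i (d (i + 1) (d i m)) = d (i + 1) (d i (d (i + 1) m))
  far : ∀ i j, i + 1 < j → j ≤ N → ∀ m, d i (d j m) = -d j (d i m)
  braidD : ∀ i, i + 1 = N → ∀ m, d (N + 1) (d i (d (N + 1) m)) = d i (d (N + 1) (d i m))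
  farD : ∀ i, i + 1 < N → ∀ m, d (N + 1) (d i m) = -d i (d (N + 1) m)
  commD : ∀ m, d (N + 1) (d N m) = d N (d (N + 1) m)
  dx : ∀ i, i ≤ N → ∀ m, d i (x i m) = m - x (i + 1) (d i m)
  xd : ∀ i, i ≤ N → ∀ m, d i (x (i + 1) m) = m - x i (d i m)
  dxFar : ∀ i j, i ≤ N → j ≤ N + 1 → j ≠ i → j ≠ i + 1 → ∀ m, d i (x j m) = -x j (d i m)
  dxD : ∀ m, d (N + 1) (x N m) = m + x (N + 1) (d (N + 1) m)
  xdD : ∀ m, d (N + 1) (x (N + 1) m) = x N (d (N + 1) m) - m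
  dxFarD : ∀ i, i < N → ∀ m, d (N + 1) (x i m) = -x i (d (N + 1) m)

/-- The subspace `V` decomposes as the direct sum of the copies `c_i U` of the subspace `U`. -/
structure Decomposes {M ι : Type} [AddCommGroup M] [Module ℚ M] [Fintype ι]
    (V U : Submodule ℚ M) (c : ι → M →ₗ[ℚ] M) : Prop where
  mem : ∀ i, ∀ u ∈ U, c i u ∈ V
  exists_sum : ∀ g ∈ V, ∃ f : ι → M, (∀ i, f i ∈ U) ∧ g = ∑ i, c i (f i)
  eq_zero : ∀ f : ι → M, (∀ i, f i ∈ U) → ∑ i, c i (f i) = 0 → ∀ i, f i = 0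

section Linear

variable {M : Type} [AddCommGroup M] [Module ℚ M]

theorem Decomposes.trans {ι κ : Type} [Fintype ι] [Fintype κ] {V U W : Submodule ℚ M}
    {c : ι → M →ₗ[ℚ] M} {c' : κ → M →ₗ[ℚ] M} (h : Decomposes V U c) (h' : Decomposes U W c') :
    Decomposes V W (fun p : ι × κ => c p.1 ∘ₗ c' p.2) where
  mem p u hu := h.mem _ _ (h'.mem _ _ hu)
  exists_sum g hg := by
    obtain ⟨f, hf, rfl⟩ := h.exists_sum g hg
    choose F hF hF' using fun i => h'.exists_sum (f i) (hf i)
    refine ⟨fun p => F p.1 p.2, fun p => hF _ _, ?_⟩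
    rw [Fintype.sum_prod_type]
    refine Finset.sum_congr rfl fun i _ => ?_
    rw [hF' i, map_sum]
    rfl
  eq_zero f hf h0 p := by
    rw [Fintype.sum_prod_type] at h0
    have h1 : ∑ i, c i (∑ j, c' j (f (i, j))) = 0 := by
      rw [← h0]
      refine Finset.sum_congr rfl fun i _ => ?_
      rw [map_sum]
      rfl
    have h2 := h.eq_zero _ (fun i => Submodule.sum_mem _ fun j _ => h'.mem j _ (hf (i, j))) h1 p.1
    exact h'.eq_zero _ (fun j => hf (p.1, j)) h2 p.2

/-- A triangularity criterion for a decomposition: the operators `P_i` detect the summands `c_i U`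
one after the other, from the last one down. -/
theorem Decomposes.of_triangular {U V : Submodule ℚ M} {P c : ℕ → M →ₗ[ℚ] M} {L : ℕ} (hL : 0 < L)
    (hP : ∀ g ∈ V, P 0 g = 0 → g = 0) (hc : ∀ i < L, ∀ u ∈ U, c i u ∈ V)
    (hU : ∀ i < L, ∀ g ∈ V, (∀ j, i < j → j < L → P j g = 0) → P i g ∈ U)
    (hlt : ∀ i j, j < i → i < L → ∀ u ∈ U, P i (c j u) = 0)
    (hdiag : ∀ i < L, ∃ κ : ℚ, κ ≠ 0 ∧ ∀ u ∈ U, P i (c i u) = κ • u) :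
    Decomposes V U (fun i : Fin L => c i) where
  mem i := hc i i.2
  exists_sum := by
    have key : ∀ k ≤ L, ∀ g ∈ V, (∀ j, k ≤ j → j < L → P j g = 0) →
        ∃ f : ℕ → M, (∀ i, f i ∈ U) ∧ g = ∑ i ∈ Finset.range k, c i (f i) := by
      intro k
      induction k with
      | zero =>
        intro _ g hg h0
        exact ⟨0, fun _ => zero_mem _, by simpa using hP g hg (h0 0 le_rfl hL)⟩
      | succ k ih =>
        intro hk g hg h0
        obtain ⟨κ, hκ, hκ'⟩ := hdiag k hk
        have hPU : κ⁻¹ • P k g ∈ U := U.smul_mem _ (hU k hk g hg fun j hj => h0 j hj)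
        obtain ⟨f, hf, hf'⟩ := ih (by omega) (g - c k (κ⁻¹ • P k g))
          (sub_mem hg (hc k hk _ hPU)) (by
            intro j hj hjL
            rcases hj.eq_or_lt with rfl | hj
            · rw [map_sub, hκ' _ hPU, smul_smul, mul_inv_cancel₀ hκ, one_smul, sub_self]
            · rw [map_sub, h0 j hj hjL, hlt j k hj hjL _ hPU, sub_zero])
        refine ⟨Function.update f k (κ⁻¹ • P k g), fun i => ?_, ?_⟩
        · rcases eq_or_ne i k with rfl | hi
          · simpa using hPU
          · simpa [hi] using hf i
        · rw [Finset.sum_range_succ, Function.update_self, ← sub_eq_iff_eq_add, hf']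
          refine Finset.sum_congr rfl fun i hi => ?_
          rw [Function.update_of_ne (Finset.mem_range.1 hi).ne]
    intro g hg
    obtain ⟨f, hf, hf'⟩ := key L le_rfl g hg fun j h1 h2 => by omega
    exact ⟨fun i => f i, fun i => hf i, by rw [hf', Finset.sum_range]⟩
  eq_zero := by
    have key : ∀ k ≤ L, ∀ f : ℕ → M, (∀ i, i < k → f i ∈ U) →
        ∑ i ∈ Finset.range k, c i (f i) = 0 → ∀ i < k, f i = 0 := by
      intro k
      induction k with
      | zero => intro _ _ _ _ i hi; omega
      | succ k ih =>
        intro hk f hf h0 i hi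
        obtain ⟨κ, hκ, hκ'⟩ := hdiag k hk
        have hfk : f k = 0 := by
          have := congrArg (P k) h0
          rw [Finset.sum_range_succ, map_add, map_sum, map_zero, hκ' _ (hf k (by omega)),
            Finset.sum_eq_zero, zero_add] at this
          · exact (smul_eq_zero.1 this).resolve_left hκ
          · intro j hj
            have hj := Finset.mem_range.1 hj
            exact hlt k j hj hk _ (hf j (by omega))
        rcases (Nat.lt_succ_iff.1 hi).eq_or_lt with rfl | hi
        · exact hfk
        · refine ih (by omega) f (fun i hi => hf i (by omega)) ?_ i hi
          rwa [Finset.sum_range_succ, hfk, map_zero, add_zero] at h0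
    intro f hf h0 i
    have := key L le_rfl (fun j => if h : j < L then f ⟨j, h⟩ else 0)
      (fun j hj => by simpa [hj] using hf _) (by rw [Finset.sum_range]; simpa using h0) i i.2
    simpa using this

end Linear

namespace SpinAction

variable {N : ℕ} {M : Type} [AddCommGroup M] [Module ℚ M] (A : SpinAction N M)

/-- The action of the monomial with a given list of variables. -/
def word (l : List ℕ) : M →ₗ[ℚ] M := (l.map A.x).prod

theorem word_nil (m : M) : A.word [] m = m := rfl

theorem word_cons (i : ℕ) (l : List ℕ) (m : M) : A.word (i :: l) m = A.x i (A.word l m) := rfl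

theorem word_append (l l' : List ℕ) : A.word (l ++ l') = A.word l ∘ₗ A.word l' := by
  simp [word, Module.End.mul_eq_comp]

/-- The common kernel of the operators of the subdiagram of type `D_{N+2-r}`, whose nodes are
`r, …, N + 1`. For `r = N + 1` this subdiagram is empty (the type is `D_1`). -/
def inv (r : ℕ) : Submodule ℚ M where
  carrier := {m | r ≤ N → ∀ j, r ≤ j → j ≤ N + 1 → A.d j m = 0}
  add_mem' h h' hr j hj hj' := by rw [map_add, h hr j hj hj', h' hr j hj hj', add_zero]
  zero_mem' _ _ _ _ := map_zero _
  smul_mem' c m h hr j hj hj' := by rw [map_smul, h hr j hj hj', smul_zero]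

theorem inv_le (r : ℕ) : A.inv r ≤ A.inv (r + 1) :=
  fun _ h hr j hj hj' => h (by omega) j (by omega) hj'

theorem d_far {i j : ℕ} (h : (i + 1 < j ∧ j ≤ N) ∨ (j + 1 < i ∧ i ≤ N) ∨
    (j = N + 1 ∧ i + 1 < N) ∨ (i = N + 1 ∧ j + 1 < N)) {m : M} (hm : A.d j m = 0) :
    A.d j (A.d i m) = 0 := by
  have : A.d j (A.d i m) = -A.d i (A.d j m) := by
    rcases h with ⟨h, h'⟩ | ⟨h, h'⟩ | ⟨rfl, h⟩ | ⟨rfl, h⟩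
    · rw [A.far i j h h', neg_neg]
    · rw [A.far j i h h']
    · rw [A.farD i h]
    · rw [A.farD j h, neg_neg]
  rw [this, hm, map_zero, neg_zero]

theorem d_braid {i j : ℕ} (h : (i + 1 = j ∧ j ≤ N) ∨ (j + 1 = i ∧ i ≤ N) ∨
    (j = N + 1 ∧ i + 1 = N) ∨ (i = N + 1 ∧ j + 1 = N)) {m : M} (hm : A.d i m = 0) :
    A.d j (A.d i (A.d j m)) = 0 := by
  have : A.d j (A.d i (A.d j m)) = A.d i (A.d j (A.d i m)) := by
    rcases h with ⟨rfl, h'⟩ | ⟨rfl, h'⟩ | ⟨rfl, h⟩ | ⟨rfl, h⟩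
    · rw [A.braid i h']
    · rw [A.braid j h']
    · rw [A.braidD i h]
    · rw [A.braidD j h]
  rw [this, hm, map_zero, map_zero]

/-! ### The operators of one step of the tower -/

/-- The operator `∂_{r+k-1} ⋯ ∂_{r+1} ∂_r`. -/
def up (r : ℕ) : ℕ → M →ₗ[ℚ] M
  | 0 => LinearMap.id
  | k + 1 => A.d (r + k) ∘ₗ up r k

/-- The operator `∂_{N-k} ⋯ ∂_{N-1} (∂_{N+1} ∂_N) ∂_{N-1} ⋯ ∂_r`. -/
def down (r : ℕ) : ℕ → M →ₗ[ℚ] M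
  | 0 => A.d (N + 1) ∘ₗ A.d N ∘ₗ A.up r (N - r)
  | k + 1 => A.d (N - 1 - k) ∘ₗ down r k

theorem up_zero (r : ℕ) (m : M) : A.up r 0 m = m := rfl

theorem up_succ (r k : ℕ) (m : M) : A.up r (k + 1) m = A.d (r + k) (A.up r k m) := rfl

theorem down_succ (r k : ℕ) (m : M) : A.down r (k + 1) m = A.d (N - 1 - k) (A.down r k m) := rfl

section Step

variable {r s : ℕ} (hN : r + s = N)
include hN

theorem down_zero (m : M) : A.down r 0 m = A.d (N + 1) (A.d N (A.up r s m)) := by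
  have : N - r = s := by omega
  simp [down, this]

theorem down_zero' (m : M) : A.down r 0 m = A.d N (A.d (N + 1) (A.up r s m)) := by
  rw [A.down_zero hN, A.commD]

/-- On `inv (r + 1)`, the operator `up r k` lands in the kernel of every `∂_j` with `j ≥ r` that does
not lengthen it. The cases `k = s` and `j ∈ {N, N + 1}` are those of the two end nodes. -/
theorem d_up {g : M} (hg : g ∈ A.inv (r + 1)) : ∀ k ≤ s, ∀ j, r ≤ j → j ≤ N + 1 → j ≠ r + k →
    ¬(k = s ∧ j = N + 1) → A.d j (A.up r k g) = 0 := by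
  intro k
  induction k using Nat.strong_induction_on with
  | _ k ih =>
    intro hk j hj hj' hjk hjs
    match k, ih with
    | 0, _ =>
      exact hg (by omega) j (by omega) hj'
    | k + 1, ih =>
      rw [up_succ]
      by_cases h1 : j = r + k
      · subst h1
        exact A.sq _ hj' _
      by_cases h2 : j + 1 = r + k
      · obtain ⟨k, rfl⟩ : ∃ k', k = k' + 1 := ⟨k - 1, by omega⟩
        obtain rfl : j = r + k := by omega
        rw [up_succ]
        exact A.d_braid (by omega) (ih k (by omega) (by omega) _ (by omega) (by omega) (by omega)
          (by omega))
      · exact A.d_far (by omega) (ih k (by omega) (by omega) j hj hj' (by omega) (by omega))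

theorem d_up_left {g : M} (hg : g ∈ A.inv (r + 1)) {j : ℕ} (hj : r ≤ j) (hj' : j ≤ N) :
    A.d j (A.d N (A.up r s g)) = 0 := by
  by_cases h1 : j = N
  · subst h1
    exact A.sq _ (by omega) _
  by_cases h2 : j + 1 = N
  · obtain ⟨s, rfl⟩ : ∃ s', s = s' + 1 := ⟨s - 1, by omega⟩
    obtain rfl : j = r + s := by omega
    rw [up_succ]
    exact A.d_braid (by omega) (A.d_up hN hg s (by omega) _ (by omega) (by omega) (by omega)
      (by omega))
  · exact A.d_far (by omega) (A.d_up hN hg s le_rfl j hj (by omega) (by omega) (by omega))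

theorem d_up_right {g : M} (hg : g ∈ A.inv (r + 1)) {j : ℕ} (hj : r ≤ j) (hj' : j ≤ N + 1)
    (hjN : j ≠ N) : A.d j (A.d (N + 1) (A.up r s g)) = 0 := by
  by_cases h1 : j = N + 1
  · subst h1
    exact A.sq _ (by omega) _
  by_cases h2 : j + 1 = N
  · obtain ⟨s, rfl⟩ : ∃ s', s = s' + 1 := ⟨s - 1, by omega⟩
    obtain rfl : j = r + s := by omega
    rw [up_succ]
    exact A.d_braid (by omega) (A.d_up hN hg s (by omega) _ (by omega) (by omega) (by omega)
      (by omega))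
  · exact A.d_far (by omega) (A.d_up hN hg s le_rfl j hj (by omega) (by omega) (by omega))

/-- On `inv (r + 1)`, the only `∂_j` with `j ≥ r` that may fail to kill `down r k` is the one that
lengthens it. -/
theorem d_down {g : M} (hg : g ∈ A.inv (r + 1)) : ∀ k ≤ s, ∀ j, r ≤ j → j ≤ N + 1 →
    j + k + 1 ≠ N → A.d j (A.down r k g) = 0 := by
  intro k
  induction k using Nat.strong_induction_on with
  | _ k ih =>
    intro hk j hj hj' hjk
    match k, ih with
    | 0, _ =>
      by_cases h1 : j = N
      · subst h1
        rw [A.down_zero' hN]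
        exact A.sq _ hj' _
      by_cases h2 : j = N + 1
      · subst h2
        rw [A.down_zero hN]
        exact A.sq _ hj' _
      · rw [A.down_zero hN]
        exact A.d_far (by omega) (A.d_up_left hN hg hj (by omega))
    | 1, ih =>
      rw [down_succ, Nat.sub_zero]
      by_cases h1 : j = N - 1
      · subst h1
        exact A.sq _ hj' _
      by_cases h2 : j = N
      · rw [A.down_zero' hN, h2]
        exact A.d_braid (by omega) (A.d_up_right hN hg (by omega) (by omega) (by omega))
      by_cases h3 : j = N + 1
      · rw [A.down_zero hN, h3]
        exact A.d_braid (by omega) (A.d_up_left hN hg (by omega) (by omega))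
      · exact A.d_far (by omega) (ih 0 (by omega) (by omega) j hj hj' (by omega))
    | k + 2, ih =>
      rw [down_succ]
      by_cases h1 : j = N - 1 - (k + 1)
      · subst h1
        exact A.sq _ hj' _
      by_cases h2 : j + k + 1 = N
      · obtain rfl : j = N - 1 - k := by omega
        rw [down_succ]
        exact A.d_braid (by omega) (ih k (by omega) (by omega) _ (by omega) (by omega) (by omega))
      · exact A.d_far (by omega) (ih (k + 1) (by omega) (by omega) j hj hj' (by omega))

/-! ### The effect of the variable `x_r` -/

theorem x_mem_inv {g : M} (hg : g ∈ A.inv (r + 1)) : A.x r g ∈ A.inv (r + 1) := by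
  intro hr j hj hj'
  have h : A.d j (A.x r g) = -A.x r (A.d j g) := by
    rcases hj'.eq_or_lt with rfl | h
    · exact A.dxFarD r (by omega) g
    · exact A.dxFar j r (by omega) (by omega) (by omega) (by omega) g
  rw [h, hg hr j hj hj', map_zero, neg_zero]

/-- Up to a sign, `up r (k + 1)` commutes with `x_r` modulo the shorter operator `up r k`. This and
its analogues for the longer operators evaluate all operators at the powers of `x_r`. -/
theorem up_x (k : ℕ) (hk : k + 1 ≤ s) : ∃ ε : ℚ, ε ≠ 0 ∧ ∀ g ∈ A.inv (r + 1),
    A.up r (k + 1) (A.x r g) = ε • (A.up r k g - A.x (r + k + 1) (A.up r (k + 1) g)) := by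
  induction k with
  | zero =>
    refine ⟨1, one_ne_zero, fun g hg => ?_⟩
    rw [up_succ, up_succ, up_zero, up_zero, one_smul]
    exact A.dx r (by omega) g
  | succ k ih =>
    obtain ⟨ε, h0, h⟩ := ih (by omega)
    refine ⟨-ε, neg_ne_zero.2 h0, fun g hg => ?_⟩
    rw [up_succ, h g hg, map_smul, map_sub, ← add_assoc,
      A.d_up hN hg k (by omega) _ (by omega) (by omega) (by omega) (by omega),
      A.dx _ (by omega), zero_sub, smul_neg, neg_smul]
    rfl

theorem branch_x : ∃ ε : ℚ, ε ≠ 0 ∧ ∀ g ∈ A.inv (r + 1),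
    A.d N (A.up r s (A.x r g)) = ε • (A.up r s g - A.x (N + 1) (A.d N (A.up r s g))) ∧
    A.d (N + 1) (A.up r s (A.x r g)) =
      ε • (A.up r s g + A.x (N + 1) (A.d (N + 1) (A.up r s g))) := by
  match s, hN with
  | 0, hN =>
    obtain rfl : r = N := hN
    refine ⟨1, one_ne_zero, fun g hg => ?_⟩
    simp only [up_zero, one_smul]
    exact ⟨A.dx _ le_rfl g, A.dxD g⟩
  | s + 1, hN =>
    obtain ⟨ε, h0, h⟩ := A.up_x hN s le_rfl
    obtain rfl : r + s + 1 = N := hN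
    refine ⟨-ε, neg_ne_zero.2 h0, fun g hg => ?_⟩
    rw [h g hg, map_smul, map_smul, map_sub, map_sub,
      A.d_up hN hg s (by omega) _ (by omega) (by omega) (by omega) (by omega),
      A.d_up hN hg s (by omega) (r + s + 1 + 1) (by omega) (by omega) (by omega) (by omega),
      A.dx _ le_rfl, A.dxD, zero_sub, zero_sub, smul_neg, smul_neg, neg_smul, neg_smul]
    exact ⟨rfl, rfl⟩

theorem down_zero_x : ∃ ε : ℚ, ε ≠ 0 ∧ ∀ g ∈ A.inv (r + 1), A.down r 0 (A.x r g) =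
    ε • (A.d N (A.up r s g) + A.d (N + 1) (A.up r s g) - A.x N (A.down r 0 g)) := by
  obtain ⟨ε, h0, h⟩ := A.branch_x hN
  refine ⟨ε, h0, fun g hg => ?_⟩
  rw [A.down_zero hN, A.down_zero hN, (h g hg).1, map_smul, map_sub, A.xdD]
  congr 1
  abel

theorem down_x (k : ℕ) (hk : k + 1 ≤ s) : ∃ ε : ℚ, ε ≠ 0 ∧ ∀ g ∈ A.inv (r + 1),
    A.down r (k + 1) (A.x r g) =
      ε • (A.down r k g - A.x (N - 1 - k) (A.down r (k + 1) g)) := by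
  induction k with
  | zero =>
    obtain ⟨ε, h0, h⟩ := A.down_zero_x hN
    refine ⟨-ε, neg_ne_zero.2 h0, fun g hg => ?_⟩
    have hx := A.xd (N - 1) (by omega) (A.down r 0 g)
    rw [show N - 1 + 1 = N by omega] at hx
    rw [down_succ, down_succ, Nat.sub_zero, h g hg, map_smul, map_sub, map_add, hx,
      A.d_up_left hN hg (by omega) (by omega), A.d_up_right hN hg (by omega) (by omega) (by omega),
      add_zero, zero_sub, smul_neg, neg_smul]
  | succ k ih =>
    obtain ⟨ε, h0, h⟩ := ih (by omega)
    refine ⟨-ε, neg_ne_zero.2 h0, fun g hg => ?_⟩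
    have hx := A.xd (N - 1 - (k + 1)) (by omega) (A.down r (k + 1) g)
    rw [show N - 1 - (k + 1) + 1 = N - 1 - k by omega] at hx
    rw [A.down_succ r (k + 1), A.down_succ r (k + 1), h g hg, map_smul, map_sub, hx,
      A.d_down hN hg k (by omega) _ (by omega) (by omega) (by omega),
      zero_sub, smul_neg, neg_smul]

end Step

/-! ### The products `x_a x_{a+1} ⋯ x_{N+1}` -/

theorem d_tail_far {j : ℕ} {u : M} (hu : A.d j u = 0) (b : ℕ) :
    ∀ a, j + 1 < a → a + b = N + 2 → A.d j (A.word (List.range' a b) u) = 0 := by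
  induction b with
  | zero => exact fun _ _ _ => hu
  | succ b ih =>
    intro a ha hab
    rw [List.range'_succ, word_cons, A.dxFar j a (by omega) (by omega) (by omega) (by omega),
      ih (a + 1) (by omega) (by omega), map_zero, neg_zero]

theorem d_tail_first {j b : ℕ} {u : M} (hu : A.d j u = 0) (h : j + b = N) :
    A.d j (A.word (List.range' (j + 1) (b + 1)) u) = A.word (List.range' (j + 2) b) u := by
  rw [List.range'_succ, word_cons, A.xd j (by omega), A.d_tail_far hu b _ (by omega) (by omega),
    map_zero, sub_zero]

/-- The product of the last variables is invariant under their own group of type `D`. -/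
theorem d_tail (b : ℕ) : ∀ a j, a ≤ j → j ≤ N + 1 → a + b = N → ∀ {u : M}, A.d j u = 0 →
    A.d j (A.word (List.range' a (b + 2)) u) = 0 := by
  induction b with
  | zero =>
    intro a j ha hj hab u hu
    obtain rfl : a = N := by omega
    simp only [List.range'_succ, word_cons, List.range'_zero, word_nil]
    obtain rfl | rfl : j = a ∨ j = a + 1 := by omega
    · rw [A.dx _ le_rfl, A.xd _ le_rfl, hu]
      simp
    · rw [A.dxD, A.xdD, hu]
      simp
  | succ b ih =>
    intro a j ha hj hab u hu
    rw [List.range'_succ, word_cons]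
    rcases ha.eq_or_lt with rfl | ha
    · rw [A.dx _ (by omega), A.d_tail_first hu (by omega), List.range'_succ, word_cons, sub_self]
    have : ∀ m, A.d j (A.x a m) = -A.x a (A.d j m) := by
      rcases hj.eq_or_lt with rfl | hj
      · exact A.dxFarD a (by omega)
      · exact A.dxFar j a (by omega) (by omega) (by omega) (by omega)
    rw [this, ih (a + 1) j (by omega) hj (by omega) hu, map_zero, neg_zero]

section Step

variable {r s : ℕ} (hN : r + s = N)
include hN

theorem tail_mem_inv {u : M} (hu : u ∈ A.inv r) :
    A.word (List.range' (r + 1) (s + 1)) u ∈ A.inv (r + 1) := by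
  intro hr j hj hj'
  obtain ⟨s, rfl⟩ : ∃ s', s = s' + 1 := ⟨s - 1, by omega⟩
  exact A.d_tail s _ j hj hj' (by omega) (hu (by omega) j (by omega) hj')

theorem up_tail {u : M} (hu : u ∈ A.inv r) : ∀ k ≤ s,
    A.up r k (A.word (List.range' (r + 1) (s + 1)) u) =
      A.word (List.range' (r + k + 1) (s + 1 - k)) u := by
  intro k
  induction k with
  | zero => exact fun _ => rfl
  | succ k ih =>
    intro hk
    rw [up_succ, ih (by omega), show s + 1 - k = (s - k) + 1 by omega,
      A.d_tail_first (hu (by omega) _ (by omega) (by omega)) (by omega)]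
    congr 3
    omega

theorem up_tail_last {u : M} (hu : u ∈ A.inv r) :
    A.up r s (A.word (List.range' (r + 1) (s + 1)) u) = A.x (N + 1) u := by
  rw [A.up_tail hN hu s le_rfl, Nat.add_sub_cancel_left, hN]
  rfl

theorem left_tail {u : M} (hu : u ∈ A.inv r) :
    A.d N (A.up r s (A.word (List.range' (r + 1) (s + 1)) u)) = u := by
  rw [A.up_tail_last hN hu, A.xd N le_rfl, hu (by omega) N (by omega) (by omega), map_zero,
    sub_zero]

theorem right_tail {u : M} (hu : u ∈ A.inv r) :
    A.d (N + 1) (A.up r s (A.word (List.range' (r + 1) (s + 1)) u)) = -u := by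
  rw [A.up_tail_last hN hu, A.xdD, hu (by omega) (N + 1) (by omega) le_rfl, map_zero, zero_sub]

theorem down_tail {u : M} (hu : u ∈ A.inv r) (k : ℕ) :
    k ≤ s → A.down r k (A.word (List.range' (r + 1) (s + 1)) u) = 0 := by
  induction k with
  | zero =>
    intro _
    rw [A.down_zero hN, A.left_tail hN hu, hu (by omega) (N + 1) (by omega) le_rfl]
  | succ k ih =>
    intro hk
    rw [down_succ, ih (by omega), map_zero]

/-! ### The powers of `x_r` -/

theorem pow_mem_inv {u : M} (hu : u ∈ A.inv r) (k : ℕ) :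
    A.word (List.replicate k r) u ∈ A.inv (r + 1) := by
  induction k with
  | zero => exact A.inv_le r hu
  | succ k ih => exact A.x_mem_inv hN ih

theorem up_pow (k : ℕ) (hk : k ≤ s) : ∃ κ : ℚ, κ ≠ 0 ∧ ∀ u ∈ A.inv r,
    A.up r k (A.word (List.replicate k r) u) = κ • u := by
  induction k with
  | zero => exact ⟨1, one_ne_zero, fun u _ => (one_smul ℚ u).symm⟩
  | succ k ih =>
    obtain ⟨κ, hκ, h⟩ := ih (by omega)
    obtain ⟨ε, hε, h'⟩ := A.up_x hN k hk
    refine ⟨ε * κ, mul_ne_zero hε hκ, fun u hu => ?_⟩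
    rw [List.replicate_succ, word_cons, h' _ (A.pow_mem_inv hN hu k), up_succ, h u hu, map_smul,
      hu (by omega) (r + k) (by omega) (by omega), smul_zero, map_zero, sub_zero, smul_smul]

theorem up_pow_lt {k i : ℕ} (hk : k < i) (hi : i ≤ s) {u : M} (hu : u ∈ A.inv r) :
    A.up r i (A.word (List.replicate k r) u) = 0 := by
  induction i with
  | zero => omega
  | succ i ih =>
    rw [up_succ]
    rcases (Nat.lt_succ_iff.1 hk).eq_or_lt with rfl | hk
    · obtain ⟨κ, hκ, h⟩ := A.up_pow hN k (by omega)
      rw [h u hu, map_smul, hu (by omega) (r + k) (by omega) (by omega), smul_zero]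
    · rw [ih hk (by omega), map_zero]

theorem branch_pow_lt {k : ℕ} (hk : k ≤ s) {u : M} (hu : u ∈ A.inv r) {j : ℕ} (hj : N ≤ j)
    (hj' : j ≤ N + 1) : A.d j (A.up r s (A.word (List.replicate k r) u)) = 0 := by
  rcases hk.eq_or_lt with rfl | hk
  · obtain ⟨κ, hκ, h⟩ := A.up_pow hN k le_rfl
    rw [h u hu, map_smul, hu (by omega) j (by omega) hj', smul_zero]
  · rw [A.up_pow_lt hN hk le_rfl hu, map_zero]

theorem branch_pow : ∃ κ : ℚ, κ ≠ 0 ∧ ∀ u ∈ A.inv r,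
    A.d N (A.up r s (A.word (List.replicate (s + 1) r) u)) = κ • u ∧
    A.d (N + 1) (A.up r s (A.word (List.replicate (s + 1) r) u)) = κ • u := by
  obtain ⟨κ, hκ, h⟩ := A.up_pow hN s le_rfl
  obtain ⟨ε, hε, h'⟩ := A.branch_x hN
  refine ⟨ε * κ, mul_ne_zero hε hκ, fun u hu => ?_⟩
  obtain ⟨h1, h2⟩ := h' _ (A.pow_mem_inv hN hu s)
  rw [List.replicate_succ, word_cons, h1, h2,
    A.branch_pow_lt hN le_rfl hu le_rfl (by omega), A.branch_pow_lt hN le_rfl hu (by omega) le_rfl,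
    h u hu, map_zero, sub_zero, add_zero, smul_smul]
  exact ⟨rfl, rfl⟩

/-- The operator `down r i` has length `i + s + 2`: it sends the power of `x_r` of this degree to a
nonzero constant, and kills the lower powers. -/
theorem down_pow_lt (i : ℕ) : ∀ k, k < i + s + 2 → i ≤ s → (∃ κ : ℚ, κ ≠ 0 ∧ ∀ u ∈ A.inv r,
      A.down r i (A.word (List.replicate (i + s + 2) r) u) = κ • u) ∧
    ∀ u ∈ A.inv r, A.down r i (A.word (List.replicate k r) u) = 0 := by
  induction i with
  | zero =>
    intro k hk _
    have h0 : ∀ k < 0 + s + 2, ∀ u ∈ A.inv r, A.down r 0 (A.word (List.replicate k r) u) = 0 := by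
      intro k hk u hu
      rw [A.down_zero hN]
      rcases (show k ≤ s + 1 by omega).eq_or_lt with rfl | hk
      · obtain ⟨κ, hκ, h⟩ := A.branch_pow hN
        rw [(h u hu).1, map_smul, hu (by omega) _ (by omega) le_rfl, smul_zero]
      · rw [A.branch_pow_lt hN (by omega) hu le_rfl (by omega), map_zero]
    refine ⟨?_, h0 k hk⟩
    obtain ⟨κ, hκ, h⟩ := A.branch_pow hN
    obtain ⟨ε, hε, h'⟩ := A.down_zero_x hN
    -- The two end nodes contribute equally, whence the factor `2` that has to be inverted.
    refine ⟨ε * (2 * κ), mul_ne_zero hε (mul_ne_zero two_ne_zero hκ), fun u hu => ?_⟩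
    rw [zero_add, List.replicate_succ, word_cons, h' _ (A.pow_mem_inv hN hu _), (h u hu).1,
      (h u hu).2, h0 _ (by omega) u hu, map_zero, sub_zero, ← add_smul, smul_smul, two_mul]
  | succ i ih =>
    intro k hk hi
    obtain ⟨⟨κ, hκ, h⟩, -⟩ := ih 0 (by omega) (by omega)
    have h0 : ∀ k < i + 1 + s + 2, ∀ u ∈ A.inv r,
        A.down r (i + 1) (A.word (List.replicate k r) u) = 0 := by
      intro k hk u hu
      rw [down_succ]
      rcases (show k ≤ i + s + 2 by omega).eq_or_lt with rfl | hk
      · rw [h u hu, map_smul, hu (by omega) _ (by omega) (by omega), smul_zero]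
      · rw [(ih k hk (by omega)).2 u hu, map_zero]
    refine ⟨?_, h0 k hk⟩
    obtain ⟨ε, hε, h'⟩ := A.down_x hN i hi
    refine ⟨ε * κ, mul_ne_zero hε hκ, fun u hu => ?_⟩
    rw [show i + 1 + s + 2 = i + s + 2 + 1 by omega, List.replicate_succ, word_cons,
      h' _ (A.pow_mem_inv hN hu _), h u hu, h0 _ (by omega) u hu, map_zero, sub_zero, smul_smul]

end Step

end SpinAction

/-! ### One step of the tower -/

/-- The monomials of one step of the tower: the powers `x_r^i` for `i ≤ 2 s + 2`, and the product
`x_{r+1} ⋯ x_{r+s+1}`, which is inserted after the power `x_r^{s+1}` of the same degree. -/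
def stepWord (r s i : ℕ) : List ℕ :=
  if i ≤ s + 1 then List.replicate i r
  else if i = s + 2 then List.range' (r + 1) (s + 1)
  else List.replicate (i - 1) r

theorem stepWord_pow {r s i : ℕ} (hi : i ≤ s + 1) : stepWord r s i = List.replicate i r := by
  simp [stepWord, hi]

theorem stepWord_tail (r s : ℕ) : stepWord r s (s + 2) = List.range' (r + 1) (s + 1) := by
  simp [stepWord]

theorem stepWord_pow' (r s i : ℕ) : stepWord r s (i + (s + 3)) = List.replicate (i + s + 2) r := by
  rw [stepWord, if_neg (by omega), if_neg (by omega)]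
  rfl

theorem step_cases (s i : ℕ) : i ≤ s ∨ i = s + 1 ∨ i = s + 2 ∨ ∃ k, i = k + (s + 3) := by
  by_cases h : s + 3 ≤ i
  · exact Or.inr (Or.inr (Or.inr ⟨i - (s + 3), by omega⟩))
  · omega

namespace SpinAction

variable {N : ℕ} {M : Type} [AddCommGroup M] [Module ℚ M] (A : SpinAction N M)

/-- The operators that detect the monomials of one step of the tower, in the order of `stepWord`:
those of the minimal coset representatives, except that the two in the middle, which differ by the
end nodes, are replaced by their sum and their difference. -/
def stepOp (r s i : ℕ) : M →ₗ[ℚ] M :=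
  if i ≤ s then A.up r i
  else if i = s + 1 then A.d N ∘ₗ A.up r s + A.d (N + 1) ∘ₗ A.up r s
  else if i = s + 2 then A.d N ∘ₗ A.up r s - A.d (N + 1) ∘ₗ A.up r s
  else A.down r (i - (s + 3))

section Step

variable {r s : ℕ}

theorem stepOp_up {i : ℕ} (hi : i ≤ s) (m : M) : A.stepOp r s i m = A.up r i m := by
  simp [stepOp, hi]

theorem stepOp_add (m : M) :
    A.stepOp r s (s + 1) m = A.d N (A.up r s m) + A.d (N + 1) (A.up r s m) := by
  simp [stepOp]

theorem stepOp_sub (m : M) :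
    A.stepOp r s (s + 2) m = A.d N (A.up r s m) - A.d (N + 1) (A.up r s m) := by
  simp [stepOp]

theorem stepOp_down (i : ℕ) (m : M) : A.stepOp r s (i + (s + 3)) m = A.down r i m := by
  rw [stepOp, if_neg (by omega), if_neg (by omega), if_neg (by omega), Nat.add_sub_cancel]

variable (hN : r + s = N)
include hN

theorem stepOp_stepWord_lt {i j : ℕ} (hji : j < i) (hi : i < 2 * s + 4) {u : M}
    (hu : u ∈ A.inv r) : A.stepOp r s i (A.word (stepWord r s j) u) = 0 := by
  rcases step_cases s i with h | rfl | rfl | ⟨k, rfl⟩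
  · rw [A.stepOp_up h, stepWord_pow (by omega), A.up_pow_lt hN hji h hu]
  · rw [A.stepOp_add, stepWord_pow (by omega), A.branch_pow_lt hN (by omega) hu le_rfl (by omega),
      A.branch_pow_lt hN (by omega) hu (by omega) le_rfl, add_zero]
  · rw [A.stepOp_sub, stepWord_pow (by omega)]
    rcases (show j ≤ s + 1 by omega).eq_or_lt with rfl | hj
    · obtain ⟨κ, -, h⟩ := A.branch_pow hN
      rw [(h u hu).1, (h u hu).2, sub_self]
    · rw [A.branch_pow_lt hN (by omega) hu le_rfl (by omega),
        A.branch_pow_lt hN (by omega) hu (by omega) le_rfl, sub_zero]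
  · rw [A.stepOp_down]
    have hp : ∀ l < k + s + 2, A.down r k (A.word (List.replicate l r) u) = 0 := fun l hl =>
      (A.down_pow_lt hN k l hl (by omega)).2 u hu
    by_cases h1 : j ≤ s + 1
    · rw [stepWord_pow h1, hp _ (by omega)]
    rcases step_cases s j with h | rfl | rfl | ⟨l, rfl⟩
    · omega
    · omega
    · rw [stepWord_tail, A.down_tail hN hu k (by omega)]
    · rw [stepWord_pow', hp _ (by omega)]

theorem stepOp_stepWord_self {i : ℕ} (hi : i < 2 * s + 4) : ∃ κ : ℚ, κ ≠ 0 ∧ ∀ u ∈ A.inv r,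
    A.stepOp r s i (A.word (stepWord r s i) u) = κ • u := by
  rcases step_cases s i with h | rfl | rfl | ⟨k, rfl⟩
  · obtain ⟨κ, hκ, h'⟩ := A.up_pow hN i h
    exact ⟨κ, hκ, fun u hu => by rw [A.stepOp_up h, stepWord_pow (by omega), h' u hu]⟩
  · obtain ⟨κ, hκ, h⟩ := A.branch_pow hN
    refine ⟨2 * κ, mul_ne_zero two_ne_zero hκ, fun u hu => ?_⟩
    rw [A.stepOp_add, stepWord_pow le_rfl, (h u hu).1, (h u hu).2, ← add_smul, two_mul]
  · refine ⟨2, two_ne_zero, fun u hu => ?_⟩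
    rw [A.stepOp_sub, stepWord_tail, A.left_tail hN hu, A.right_tail hN hu, sub_neg_eq_add,
      two_smul]
  · obtain ⟨⟨κ, hκ, h⟩, -⟩ := A.down_pow_lt hN k 0 (by omega) (by omega)
    exact ⟨κ, hκ, fun u hu => by rw [A.stepOp_down, stepWord_pow', h u hu]⟩

theorem stepOp_mem_inv {i : ℕ} (hi : i < 2 * s + 4) {g : M} (hg : g ∈ A.inv (r + 1))
    (h0 : ∀ j, i < j → j < 2 * s + 4 → A.stepOp r s j g = 0) : A.stepOp r s i g ∈ A.inv r := by
  intro _ j hj hj'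
  have hbranch : i ≤ s + 2 → A.d (N + 1) (A.d N (A.up r s g)) = 0 := fun h => by
    rw [← A.down_zero hN, ← A.stepOp_down (s := s)]
    exact h0 _ (by omega) (by omega)
  have hboth : i ≤ s + 2 → A.d j (A.d N (A.up r s g)) = 0 ∧
      A.d j (A.d (N + 1) (A.up r s g)) = 0 := by
    intro h
    constructor
    · by_cases h1 : j = N + 1
      · rw [h1, hbranch h]
      · exact A.d_up_left hN hg hj (by omega)
    · by_cases h1 : j = N
      · rw [h1, ← A.commD, hbranch h]
      · exact A.d_up_right hN hg hj hj' h1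
  rcases step_cases s i with h | rfl | rfl | ⟨k, rfl⟩
  · rw [A.stepOp_up h]
    rcases h.eq_or_lt with rfl | h
    · -- Both end nodes kill `up r s g`, because their sum and their difference do.
      have h1 := h0 (i + 1) (by omega) (by omega)
      have h2 := h0 (i + 2) (by omega) (by omega)
      rw [A.stepOp_add] at h1
      rw [A.stepOp_sub, sub_eq_zero] at h2
      rw [← h2, ← two_smul ℚ, smul_eq_zero] at h1
      have h1 := h1.resolve_left two_ne_zero
      by_cases h3 : j = N
      · rw [h3, h1]
      by_cases h4 : j = N + 1
      · rw [h4, ← h2, h1]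
      · exact A.d_up hN hg i le_rfl j hj hj' (by omega) (by omega)
    · by_cases h3 : j = r + i
      · have := h0 (i + 1) (by omega) (by omega)
        rwa [A.stepOp_up (by omega), up_succ, ← h3] at this
      · exact A.d_up hN hg i h.le j hj hj' h3 (by omega)
  · rw [A.stepOp_add, map_add, (hboth (by omega)).1, (hboth (by omega)).2, add_zero]
  · rw [A.stepOp_sub, map_sub, (hboth (by omega)).1, (hboth (by omega)).2, sub_zero]
  · rw [A.stepOp_down]
    by_cases h1 : j + k + 1 = N
    · have := h0 (k + 1 + (s + 3)) (by omega) (by omega)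
      rwa [A.stepOp_down, down_succ, show N - 1 - k = j by omega] at this
    · exact A.d_down hN hg k (by omega) j hj hj' h1

theorem decomposes_step : Decomposes (A.inv (r + 1)) (A.inv r)
    (fun i : Fin (2 * s + 4) => A.word (stepWord r s i)) := by
  refine Decomposes.of_triangular (P := A.stepOp r s) (c := fun i => A.word (stepWord r s i))
    (by omega) (fun g _ h => ?_) (fun i _ u hu => ?_)
    (fun i hi g hg h0 => A.stepOp_mem_inv hN hi hg h0)
    (fun i j hji hi u hu => A.stepOp_stepWord_lt hN hji hi hu)
    (fun i hi => A.stepOp_stepWord_self hN hi)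
  · rwa [A.stepOp_up (Nat.zero_le _)] at h
  · rcases step_cases s i with h | rfl | rfl | ⟨k, rfl⟩
    · rw [stepWord_pow (by omega)]
      exact A.pow_mem_inv hN hu _
    · rw [stepWord_pow le_rfl]
      exact A.pow_mem_inv hN hu _
    · rw [stepWord_tail]
      exact A.tail_mem_inv hN hu
    · rw [stepWord_pow']
      exact A.pow_mem_inv hN hu _

end Step

end SpinAction

/-! ### The degrees of the monomials, and the decomposition of an arbitrary representation -/

section Degrees

open LaurentPolynomial

theorem qInt_two_mul (m : ℕ) : qInt (2 * m) = qInt m * (T (m : ℤ) + T (-(m : ℤ))) := by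
  rw [mul_add, qInt, qInt, two_mul, Finset.sum_range_add, Finset.sum_mul, Finset.sum_mul]
  congr 1 <;>
  · refine Finset.sum_congr rfl fun i _ => ?_
    rw [← T_add]
    congr 1
    push_cast
    ring

theorem length_stepWord_lower {r s i : ℕ} (hi : i < s + 2) : (stepWord r s i).length = i := by
  rw [stepWord_pow (by omega), List.length_replicate]

theorem length_stepWord_upper (r s i : ℕ) :
    (stepWord r s (s + 2 + i)).length = s + 1 + i := by
  rcases i with _ | i
  · rw [add_zero, stepWord_tail, List.length_range', add_zero]
  · rw [show s + 2 + (i + 1) = i + (s + 3) by omega, stepWord_pow', List.length_replicate]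
    omega

theorem sum_T_stepWord (r s : ℕ) :
    (∑ i : Fin (2 * s + 4), T (2 * ((stepWord r s i).length : ℤ)) : LaurentPolynomial ℤ) =
      T (2 * ((s : ℤ) + 1)) * qInt (s + 2) * (T ((s : ℤ) + 1) + T (-((s : ℤ) + 1))) := by
  rw [← Finset.sum_range fun i => (T (2 * ((stepWord r s i).length : ℤ)) : LaurentPolynomial ℤ),
    show 2 * s + 4 = (s + 2) + (s + 2) by omega, Finset.sum_range_add, mul_add, add_comm, qInt,
    Finset.mul_sum, Finset.sum_mul, Finset.sum_mul]
  congr 1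
  · rw [← Finset.sum_range_reflect]
    refine Finset.sum_congr rfl fun i hi => ?_
    have hi := Finset.mem_range.1 hi
    rw [length_stepWord_upper, ← T_add, ← T_add]
    congr 1
    push_cast [show s + 2 - 1 - i = s + 1 - i by omega, show i ≤ s + 1 by omega]
    ring
  · rw [← Finset.sum_range_reflect]
    refine Finset.sum_congr rfl fun i hi => ?_
    have hi := Finset.mem_range.1 hi
    rw [length_stepWord_lower (by omega), ← T_add, ← T_add]
    congr 1
    push_cast [show s + 2 - 1 - i = s + 1 - i by omega, show i ≤ s + 1 by omega]
    ring

theorem qInt_one : qInt 1 = 1 := by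
  simp [qInt]

/-- The tower of the subdiagrams of types `D_1 ⊂ D_2 ⊂ ⋯ ⊂ D_{k+1}` decomposes every representation
by means of the same monomials, which are counted by the Weyl group of type `D_{k+1}`. -/
theorem exists_decomposes (N k : ℕ) (hk : k ≤ N + 1) :
    ∃ (ι : Type) (_ : Fintype ι) (w : ι → List ℕ), Fintype.card ι = 2 ^ k * (k + 1).factorial ∧
      (∑ i, T (2 * ((w i).length : ℤ)) : LaurentPolynomial ℤ) =
        T (((k : ℤ) + 1) * k) * qInt (k + 1) * qDoubleFactorial k ∧
      ∀ (M : Type) [AddCommGroup M] [Module ℚ M] (A : SpinAction N M),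
        Decomposes ⊤ (A.inv (N + 1 - k)) (fun i => A.word (w i)) := by
  induction k with
  | zero =>
    refine ⟨Unit, inferInstance, fun _ => [], rfl, ?_, fun M _ _ A => ?_⟩
    · simp [qInt_one, qDoubleFactorial]
    · refine ⟨fun _ _ _ => trivial, fun g _ => ⟨fun _ => g, fun _ h => ?_, ?_⟩, fun f _ h i => ?_⟩
      · omega
      · simp [SpinAction.word_nil]
      · simpa [SpinAction.word_nil] using h
  | succ k ih =>
    obtain ⟨ι, _, w, hcard, hsum, hdec⟩ := ih (by omega)
    refine ⟨ι × Fin (2 * k + 4), inferInstance, fun p => w p.1 ++ stepWord (N - k) k p.2, ?_, ?_,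
      fun M _ _ A => ?_⟩
    · rw [Fintype.card_prod, hcard, Fintype.card_fin, Nat.factorial_succ (k + 1)]
      ring
    · have hprod : (∑ p : ι × Fin (2 * k + 4),
          T (2 * ((w p.1 ++ stepWord (N - k) k p.2).length : ℤ)) : LaurentPolynomial ℤ) =
          (∑ i, T (2 * ((w i).length : ℤ))) *
            ∑ i : Fin (2 * k + 4), T (2 * ((stepWord (N - k) k i).length : ℤ)) := by
        rw [Finset.sum_mul_sum, Fintype.sum_prod_type]
        simp only [List.length_append, Nat.cast_add, mul_add, T_add]
      have hT : (T (((k + 1 : ℕ) + 1 : ℤ) * (k + 1 : ℕ)) : LaurentPolynomial ℤ) =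
          T (((k : ℤ) + 1) * k) * T (2 * ((k : ℤ) + 1)) := by
        rw [← T_add]
        congr 1
        push_cast
        ring
      rw [hprod, hsum, sum_T_stepWord, hT, qDoubleFactorial, qDoubleFactorial,
        Finset.prod_Icc_succ_top (by omega), qInt_two_mul (k + 1), Nat.cast_succ]
      ring
    · have h := (hdec M A)
      rw [show N + 1 - k = N - k + 1 by omega] at h
      have h' := h.trans (A.decomposes_step (r := N - k) (s := k) (by omega))
      rw [show N + 1 - (k + 1) = N - k by omega]
      simpa only [SpinAction.word_append] using h'

end Degrees

/-! ### The relations between the odd Demazure operators -/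

/-- An additive map out of the skew-polynomial ring vanishes if it vanishes at `1` and twists the
multiplications by the variables. -/
theorem Pol.eq_zero_of_twisted {n : ℕ} {R : Pol n →ₗ[ℤ] Pol n} (h1 : R 1 = 0)
    (hX : ∀ i, ∃ y : Pol n, ∀ f, R (Pol.X i * f) = y * R f) (f : Pol n) : R f = 0 := by
  suffices h : ∀ f g : Pol n, R g = 0 → R (f * g) = 0 by simpa using h f 1 h1
  intro f
  induction f using Pol.induction with
  | hX i =>
    intro g hg
    obtain ⟨y, hy⟩ := hX i
    rw [hy, hg, mul_zero]
  | h1 => exact fun g hg => by rwa [one_mul]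
  | hneg f hf => exact fun g hg => by rw [neg_mul, map_neg, hf g hg, neg_zero]
  | hadd f g hf hg => exact fun k hk => by rw [add_mul, map_add, hf k hk, hg k hk, add_zero]
  | hmul f g hf hg => exact fun k hk => by rw [mul_assoc]; exact hf _ (hg k hk)

section General

variable {n : ℕ}

theorem oddDem_X_mul_left {a b : Fin n} (ε : ℤˣ) (f : Pol n) :
    oddDem a b ε (Pol.X a * f) = f - (ε : ℤ) • (Pol.X b * oddDem a b ε f) := by
  rw [oddDem_mul, oddDem_X, twist_X, twistX, demX, twistSign, if_pos rfl, if_pos (Or.inl rfl),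
    Equiv.swap_apply_left, Int.cast_one, one_mul, smul_mul_assoc, neg_smul, sub_eq_add_neg]

theorem oddDem_X_mul_right {a b : Fin n} (hab : a ≠ b) (ε : ℤˣ) (f : Pol n) :
    oddDem a b ε (Pol.X b * f) = (ε : ℤ) • f - (ε : ℤ) • (Pol.X a * oddDem a b ε f) := by
  rw [oddDem_mul, oddDem_X, twist_X, twistX, demX, twistSign, if_neg hab.symm, if_pos rfl,
    if_pos (Or.inr rfl), Equiv.swap_apply_right, smul_mul_assoc, neg_smul, sub_eq_add_neg,
    ← zsmul_eq_mul]

theorem oddDem_X_mul_of_ne {a b j : Fin n} (hja : j ≠ a) (hjb : j ≠ b) (ε : ℤˣ) (f : Pol n) :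
    oddDem a b ε (Pol.X j * f) = -(Pol.X j * oddDem a b ε f) := by
  rw [oddDem_mul, oddDem_X, twist_X, twistX, demX, twistSign, if_neg hja, if_neg hjb,
    if_neg (by tauto), Equiv.swap_apply_of_ne_of_ne hja hjb, Int.cast_zero, zero_mul, zero_add,
    neg_smul, one_smul, neg_mul]

theorem oddDem_sq {a b : Fin n} (hab : a ≠ b) (ε : ℤˣ) (f : Pol n) :
    oddDem a b ε (oddDem a b ε f) = 0 := by
  refine Pol.eq_zero_of_twisted (R := oddDem a b ε ∘ₗ oddDem a b ε) (by simp) (fun j => ?_) f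
  refine ⟨Pol.X j, fun f => ?_⟩
  simp only [LinearMap.comp_apply]
  by_cases hja : j = a
  · subst hja
    rcases Int.units_eq_one_or ε with rfl | rfl <;>
      simp [oddDem_X_mul_left, oddDem_X_mul_right hab]
  by_cases hjb : j = b
  · subst hjb
    rcases Int.units_eq_one_or ε with rfl | rfl <;>
      simp [oddDem_X_mul_left, oddDem_X_mul_right hab]
  · simp [oddDem_X_mul_of_ne hja hjb]

theorem oddDem_comm {a b : Fin n} (hab : a ≠ b) (f : Pol n) :
    oddDem a b (-1) (oddDem a b 1 f) = oddDem a b 1 (oddDem a b (-1) f) := by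
  rw [← sub_eq_zero]
  refine Pol.eq_zero_of_twisted
    (R := oddDem a b (-1) ∘ₗ oddDem a b 1 - oddDem a b 1 ∘ₗ oddDem a b (-1)) (by simp)
    (fun j => ?_) f
  by_cases hja : j = a
  · subst hja
    refine ⟨-Pol.X j, fun f => ?_⟩
    simp [oddDem_X_mul_left, oddDem_X_mul_right hab, mul_sub]
    abel
  by_cases hjb : j = b
  · subst hjb
    refine ⟨-Pol.X j, fun f => ?_⟩
    simp [oddDem_X_mul_left, oddDem_X_mul_right hab, mul_sub]
    abel
  · exact ⟨Pol.X j, fun f => by simp [oddDem_X_mul_of_ne hja hjb, mul_sub]⟩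

theorem oddDem_far {a b c d : Fin n} (hab : a ≠ b) (hcd : c ≠ d) (hac : a ≠ c) (had : a ≠ d)
    (hbc : b ≠ c) (hbd : b ≠ d) (ε η : ℤˣ) (f : Pol n) :
    oddDem a b ε (oddDem c d η f) = -oddDem c d η (oddDem a b ε f) := by
  rw [← add_eq_zero_iff_eq_neg]
  refine Pol.eq_zero_of_twisted
    (R := oddDem a b ε ∘ₗ oddDem c d η + oddDem c d η ∘ₗ oddDem a b ε) (by simp)
    (fun j => ?_) f
  have key : ∀ {a b c d : Fin n} (hab : a ≠ b) (hac : a ≠ c) (had : a ≠ d)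
      (hbc : b ≠ c) (hbd : b ≠ d) (ε η : ℤˣ), (∀ f, oddDem a b ε (oddDem c d η (Pol.X a * f)) +
        oddDem c d η (oddDem a b ε (Pol.X a * f)) = ((ε : ℤ) • Pol.X b) *
          (oddDem a b ε (oddDem c d η f) + oddDem c d η (oddDem a b ε f))) ∧
      (∀ f, oddDem a b ε (oddDem c d η (Pol.X b * f)) +
        oddDem c d η (oddDem a b ε (Pol.X b * f)) = ((ε : ℤ) • Pol.X a) *
          (oddDem a b ε (oddDem c d η f) + oddDem c d η (oddDem a b ε f))) := by
    intro a b c d hab hac had hbc hbd ε η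
    constructor <;> intro f
    · rw [oddDem_X_mul_of_ne hac had, oddDem_X_mul_left, map_neg, oddDem_X_mul_left, map_sub,
        map_smul, oddDem_X_mul_of_ne hbc hbd, smul_mul_assoc, mul_add, smul_add, smul_neg]
      abel
    · rw [oddDem_X_mul_of_ne hbc hbd, oddDem_X_mul_right hab, map_neg, oddDem_X_mul_right hab,
        map_sub, map_smul, map_smul, oddDem_X_mul_of_ne hac had, smul_mul_assoc, mul_add, smul_add,
        smul_neg]
      abel
  simp only [LinearMap.add_apply, LinearMap.comp_apply]
  by_cases hja : j = a
  · subst hja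
    exact ⟨_, (key hab hac had hbc hbd ε η).1⟩
  by_cases hjb : j = b
  · subst hjb
    exact ⟨_, (key hab hac had hbc hbd ε η).2⟩
  by_cases hjc : j = c
  · subst hjc
    refine ⟨(η : ℤ) • Pol.X d, fun f => ?_⟩
    rw [add_comm, (key hcd hac.symm hbc.symm had.symm hbd.symm η ε).1, add_comm (oddDem j d η _)]
  by_cases hjd : j = d
  · subst hjd
    refine ⟨(η : ℤ) • Pol.X c, fun f => ?_⟩
    rw [add_comm, (key hcd hac.symm hbc.symm had.symm hbd.symm η ε).2, add_comm (oddDem c j η _)]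
  · refine ⟨Pol.X j, fun f => ?_⟩
    simp only [oddDem_X_mul_of_ne hja hjb, oddDem_X_mul_of_ne hjc hjd, map_neg, neg_neg, mul_add]

theorem oddDem_braid {a b c : Fin n} (hab : a ≠ b) (hac : a ≠ c) (hbc : b ≠ c) (η : ℤˣ)
    (f : Pol n) : oddDem a b 1 (oddDem b c η (oddDem a b 1 f)) =
      oddDem b c η (oddDem a b 1 (oddDem b c η f)) := by
  rw [← sub_eq_zero]
  refine Pol.eq_zero_of_twisted
    (R := oddDem a b 1 ∘ₗ oddDem b c η ∘ₗ oddDem a b 1 -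
      oddDem b c η ∘ₗ oddDem a b 1 ∘ₗ oddDem b c η) (by simp) (fun j => ?_) f
  simp only [LinearMap.sub_apply, LinearMap.comp_apply]
  by_cases hja : j = a
  · subst hja
    refine ⟨-((η : ℤ) • Pol.X c), fun f => ?_⟩
    rcases Int.units_eq_one_or η with rfl | rfl <;>
      simp [oddDem_X_mul_left, oddDem_X_mul_of_ne hab hac,
        oddDem_X_mul_of_ne hac.symm hbc.symm, oddDem_sq hab, oddDem_sq hbc, mul_sub]
    abel
  by_cases hjb : j = b
  · subst hjb
    refine ⟨-Pol.X j, fun f => ?_⟩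
    rcases Int.units_eq_one_or η with rfl | rfl <;>
      (simp [oddDem_X_mul_left, oddDem_X_mul_right hab, oddDem_X_mul_right hbc,
        oddDem_X_mul_of_ne hab hac, oddDem_X_mul_of_ne hac.symm hbc.symm, mul_sub]; abel)
  by_cases hjc : j = c
  · subst hjc
    refine ⟨-((η : ℤ) • Pol.X a), fun f => ?_⟩
    rcases Int.units_eq_one_or η with rfl | rfl <;>
      simp [oddDem_X_mul_right hab, oddDem_X_mul_right hbc, oddDem_X_mul_of_ne hab hac,
        oddDem_X_mul_of_ne hac.symm hbc.symm, oddDem_sq hab, oddDem_sq hbc, mul_sub] <;> abel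
  · refine ⟨-Pol.X j, fun f => ?_⟩
    simp only [oddDem_X_mul_of_ne hja hjb, oddDem_X_mul_of_ne hjb hjc, map_neg, neg_neg, neg_mul,
      mul_sub]

end General

/-! ### Representations of the nilHecke algebra as actions -/

/-- The action on a representation of `NH_{n,ℚ}` of the free ring on the generators. -/
noncomputable def opHom {n : ℕ} {M : Type} [AddCommGroup M] [Module ℚ M]
    (ρ : NHQ n →ₐ[ℚ] Module.End ℚ M) : FreeAlgebra ℤ (Gen n) →+* Module.End ℚ M :=
  (ρ : NHQ n →+* Module.End ℚ M).comp
    ((Algebra.TensorProduct.includeRight : NH n →ₐ[ℤ] NHQ n).toRingHom.comp (NH.mk n))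

section OpHom

variable {n : ℕ} {M : Type} [AddCommGroup M] [Module ℚ M] (ρ : NHQ n →ₐ[ℚ] Module.End ℚ M)

theorem opHom_rel {a b : FreeAlgebra ℤ (Gen n)} (h : NHRel n a b) (m : M) :
    opHom ρ a m = opHom ρ b m := by
  have : NH.mk n a = NH.mk n b := RingQuot.mkRingHom_rel h
  simp only [opHom, RingHom.comp_apply, this]

/-- The operator of the variable `x_i`, or `0` if `i` is out of range. -/
noncomputable def xOp (i : ℕ) : Module.End ℚ M := if h : i < n then opHom ρ (fx ⟨i, h⟩) else 0

/-- The operator of the generator `∂_i`, or `0` if `i` is out of range. -/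
noncomputable def dOp (i : ℕ) : Module.End ℚ M := if h : i < n then opHom ρ (fd ⟨i, h⟩) else 0

theorem xOp_of_lt {i : ℕ} (h : i < n) : xOp ρ i = opHom ρ (fx ⟨i, h⟩) := dif_pos h

theorem dOp_of_lt {i : ℕ} (h : i < n) : dOp ρ i = opHom ρ (fd ⟨i, h⟩) := dif_pos h

end OpHom

/-- The action given by a representation of `NH_{N+2,ℚ}`. -/
noncomputable def SpinAction.ofHom {N : ℕ} {M : Type} [AddCommGroup M] [Module ℚ M]
    (ρ : NHQ (N + 2) →ₐ[ℚ] Module.End ℚ M) : SpinAction N M where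
  x := xOp ρ
  d := dOp ρ
  sq i hi m := by
    have hi' : i < N + 2 := by omega
    rw [dOp_of_lt ρ hi']
    have h : NHRel (N + 2) (fd ⟨i, hi'⟩ ^ 2) 0 := by
      rcases hi.eq_or_lt with rfl | hi
      · exact .sqD _ rfl
      · exact .sq _ (by simpa using hi)
    simpa [pow_two] using opHom_rel ρ h m
  braid i hi m := by
    have h1 : i < N + 2 := by omega
    have h2 : i + 1 < N + 2 := by omega
    rw [dOp_of_lt ρ h1, dOp_of_lt ρ h2]
    simpa using opHom_rel ρ (.braid ⟨i, h1⟩ ⟨i + 1, h2⟩ rfl (by simpa using hi)) m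
  far i j hij hj m := by
    have h1 : i < N + 2 := by omega
    have h2 : j < N + 2 := by omega
    rw [dOp_of_lt ρ h1, dOp_of_lt ρ h2]
    have := opHom_rel ρ (.far ⟨i, h1⟩ ⟨j, h2⟩ (by simp; omega) (by simp; omega) (Or.inl hij)) m
    simpa [add_eq_zero_iff_eq_neg] using this
  braidD i hi m := by
    have h1 : i < N + 2 := by omega
    have h2 : N + 1 < N + 2 := by omega
    rw [dOp_of_lt ρ h1, dOp_of_lt ρ h2]
    simpa using opHom_rel ρ (.braidD ⟨i, h1⟩ ⟨N + 1, h2⟩ rfl (by simp; omega)) m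
  farD i hi m := by
    have h1 : i < N + 2 := by omega
    have h2 : N + 1 < N + 2 := by omega
    rw [dOp_of_lt ρ h1, dOp_of_lt ρ h2]
    have := opHom_rel ρ (.farD ⟨i, h1⟩ ⟨N + 1, h2⟩ rfl (by simp; omega)) m
    simpa [add_eq_zero_iff_eq_neg] using this
  commD m := by
    have h1 : N < N + 2 := by omega
    have h2 : N + 1 < N + 2 := by omega
    rw [dOp_of_lt ρ h1, dOp_of_lt ρ h2]
    have := opHom_rel ρ (.commD ⟨N, h1⟩ ⟨N + 1, h2⟩ rfl rfl) m
    simpa [sub_eq_zero] using this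
  dx i hi m := by
    have h1 : i < N + 2 := by omega
    have h2 : i + 1 < N + 2 := by omega
    rw [dOp_of_lt ρ h1, xOp_of_lt ρ h1, xOp_of_lt ρ h2, eq_sub_iff_add_eq]
    simpa using opHom_rel ρ (.dx ⟨i, h1⟩ ⟨i + 1, h2⟩ rfl) m
  xd i hi m := by
    have h1 : i < N + 2 := by omega
    have h2 : i + 1 < N + 2 := by omega
    rw [dOp_of_lt ρ h1, xOp_of_lt ρ h1, xOp_of_lt ρ h2, eq_sub_iff_add_eq']
    simpa using opHom_rel ρ (.xd ⟨i, h1⟩ ⟨i + 1, h2⟩ rfl) m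
  dxFar i j hi hj hji hji' m := by
    have h1 : i < N + 2 := by omega
    have h2 : j < N + 2 := by omega
    rw [dOp_of_lt ρ h1, xOp_of_lt ρ h2, ← add_eq_zero_iff_eq_neg]
    simpa using opHom_rel ρ (.dxFar ⟨i, h1⟩ ⟨j, h2⟩ (by simp; omega) (by simpa using hji) hji') m
  dxD m := by
    have h1 : N < N + 2 := by omega
    have h2 : N + 1 < N + 2 := by omega
    rw [dOp_of_lt ρ h2, xOp_of_lt ρ h1, xOp_of_lt ρ h2, ← sub_eq_iff_eq_add]
    simpa using opHom_rel ρ (.dxD ⟨N, h1⟩ ⟨N + 1, h2⟩ rfl rfl) m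
  xdD m := by
    have h1 : N < N + 2 := by omega
    have h2 : N + 1 < N + 2 := by omega
    rw [dOp_of_lt ρ h2, xOp_of_lt ρ h1, xOp_of_lt ρ h2, eq_sub_iff_add_eq, ← eq_sub_iff_add_eq']
    have := opHom_rel ρ (.xdD ⟨N, h1⟩ ⟨N + 1, h2⟩ rfl rfl) m
    simpa using this.symm
  dxFarD i hi m := by
    have h1 : i < N + 2 := by omega
    have h2 : N + 1 < N + 2 := by omega
    rw [dOp_of_lt ρ h2, xOp_of_lt ρ h1, ← add_eq_zero_iff_eq_neg]
    simpa using opHom_rel ρ (.dxFarD ⟨i, h1⟩ ⟨N + 1, h2⟩ rfl (by simpa using hi)) m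

/-! ### The polynomial representation -/

theorem dem_of_lt {n : ℕ} {i : Fin n} (h : (i : ℕ) + 1 < n) :
    dem i = oddDem i ⟨i + 1, h⟩ 1 := by
  rw [dem, dif_pos h]

theorem dem_last {n : ℕ} {k l : Fin n} (hl : (l : ℕ) + 1 = n) (hk : (k : ℕ) + 1 = l) :
    dem l = oddDem k l (-1) := by
  have : (⟨l - 1, lt_of_le_of_lt (Nat.sub_le _ _) l.isLt⟩ : Fin n) = k := Fin.ext (by simp; omega)
  rw [dem, dif_neg (by omega), this]

theorem dem_one {n : ℕ} (i : Fin n) : dem i 1 = 0 := by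
  unfold dem
  split_ifs <;> simp

/-- The operators on the skew-polynomial ring by which the generators act. -/
noncomputable def polOp {n : ℕ} : Gen n → Module.End ℤ (Pol n)
  | .x i => LinearMap.mulLeft ℤ (Pol.X i)
  | .d i => dem i

theorem lift_polOp_fx {n : ℕ} (i : Fin n) (f : Pol n) :
    FreeAlgebra.lift ℤ polOp (fx i) f = Pol.X i * f := by
  rw [fx, FreeAlgebra.lift_ι_apply]
  rfl

theorem lift_polOp_fd {n : ℕ} (i : Fin n) (f : Pol n) :
    FreeAlgebra.lift ℤ polOp (fd i) f = dem i f := by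
  rw [fd, FreeAlgebra.lift_ι_apply]
  rfl

theorem lift_polOp_rel {n : ℕ} (hn : 2 ≤ n) {a b : FreeAlgebra ℤ (Gen n)} (h : NHRel n a b) :
    FreeAlgebra.lift ℤ polOp a = FreeAlgebra.lift ℤ polOp b := by
  ext f
  induction h with
  | anti i j h =>
    simp [lift_polOp_fx, ← mul_assoc, ← add_mul, Pol.anti h]
  | sq i hi =>
    simp only [pow_two, map_mul, Module.End.mul_apply, lift_polOp_fd, dem_of_lt hi]
    rw [oddDem_sq (by simp [Fin.ext_iff])]
    simp
  | braid i j hij hj =>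
    have hi : (i : ℕ) + 1 < n := by omega
    have : (⟨i + 1, hi⟩ : Fin n) = j := Fin.ext hij
    simp only [map_mul, Module.End.mul_apply, lift_polOp_fd, dem_of_lt hi, dem_of_lt hj, this]
    exact oddDem_braid (by simp [Fin.ext_iff]; omega) (by simp [Fin.ext_iff]; omega)
      (by simp [Fin.ext_iff]) _ _
  | far i j hi hj hij =>
    simp only [map_add, map_mul, map_zero, LinearMap.add_apply, Module.End.mul_apply,
      lift_polOp_fd, dem_of_lt hi, dem_of_lt hj]
    rw [oddDem_far, neg_add_cancel, LinearMap.zero_apply] <;> simp [Fin.ext_iff] <;> omega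
  | xd i j hij =>
    have hi : (i : ℕ) + 1 < n := by omega
    have : (⟨i + 1, hi⟩ : Fin n) = j := Fin.ext hij
    simp only [map_add, map_mul, map_one, LinearMap.add_apply, Module.End.mul_apply,
      lift_polOp_fd, lift_polOp_fx, dem_of_lt hi, this, Module.End.one_apply]
    rw [oddDem_X_mul_right (by simp [Fin.ext_iff]; omega)]
    simp
  | dx i j hij =>
    have hi : (i : ℕ) + 1 < n := by omega
    have : (⟨i + 1, hi⟩ : Fin n) = j := Fin.ext hij
    simp only [map_add, map_mul, map_one, LinearMap.add_apply, Module.End.mul_apply,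
      lift_polOp_fd, lift_polOp_fx, dem_of_lt hi, this, Module.End.one_apply]
    rw [oddDem_X_mul_left]
    simp
  | dxFar i j hi h h' =>
    simp only [map_add, map_mul, map_zero, LinearMap.add_apply, Module.End.mul_apply,
      lift_polOp_fd, lift_polOp_fx, dem_of_lt hi]
    rw [oddDem_X_mul_of_ne h (by simp [Fin.ext_iff]; omega)]
    simp
  | sqD l hl =>
    have hk : ((⟨l - 1, by omega⟩ : Fin n) : ℕ) + 1 = l := by simp; omega
    simp only [pow_two, map_mul, Module.End.mul_apply, lift_polOp_fd, dem_last hl hk]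
    rw [oddDem_sq (by simp [Fin.ext_iff]; omega)]
    simp
  | braidD k l hl hk =>
    have hk1 : (k : ℕ) + 1 < n := by omega
    have hm : ((⟨k + 1, hk1⟩ : Fin n) : ℕ) + 1 = l := by simp; omega
    simp only [map_mul, Module.End.mul_apply, lift_polOp_fd, dem_of_lt hk1, dem_last hl hm]
    exact (oddDem_braid (by simp [Fin.ext_iff]) (by simp [Fin.ext_iff]; omega)
      (by simp [Fin.ext_iff]; omega) _ _).symm
  | farD i l hl hi =>
    have hi1 : (i : ℕ) + 1 < n := by omega
    have hk : ((⟨l - 1, by omega⟩ : Fin n) : ℕ) + 1 = l := by simp; omega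
    simp only [map_add, map_mul, map_zero, LinearMap.add_apply, Module.End.mul_apply,
      lift_polOp_fd, dem_of_lt hi1, dem_last hl hk]
    rw [oddDem_far, neg_add_cancel, LinearMap.zero_apply] <;> simp [Fin.ext_iff] <;> omega
  | commD k l hl hk =>
    have hk1 : (k : ℕ) + 1 < n := by omega
    have : (⟨k + 1, hk1⟩ : Fin n) = l := Fin.ext hk
    simp only [map_sub, map_mul, map_zero, LinearMap.sub_apply, Module.End.mul_apply,
      lift_polOp_fd, dem_of_lt hk1, dem_last hl hk, this]
    rw [oddDem_comm (by simp [Fin.ext_iff]; omega), sub_self, LinearMap.zero_apply]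
  | xdD k l hl hk =>
    simp only [map_sub, map_mul, map_one, LinearMap.sub_apply, Module.End.mul_apply,
      lift_polOp_fd, lift_polOp_fx, dem_last hl hk, Module.End.one_apply]
    rw [oddDem_X_mul_right (by simp [Fin.ext_iff]; omega)]
    simp
  | dxD k l hl hk =>
    simp only [map_sub, map_mul, map_one, LinearMap.sub_apply, Module.End.mul_apply,
      lift_polOp_fd, lift_polOp_fx, dem_last hl hk, Module.End.one_apply]
    rw [oddDem_X_mul_left]
    simp
  | dxFarD i l hl hi =>
    have hk : ((⟨l - 1, by omega⟩ : Fin n) : ℕ) + 1 = l := by simp; omega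
    simp only [map_add, map_mul, map_zero, LinearMap.add_apply, Module.End.mul_apply,
      lift_polOp_fd, lift_polOp_fx, dem_last hl hk]
    rw [oddDem_X_mul_of_ne (by simp [Fin.ext_iff]; omega) (by simp [Fin.ext_iff]; omega)]
    simp

/-- The polynomial representation of `NH_n`. -/
noncomputable def polRep {n : ℕ} (hn : 2 ≤ n) : NH n →+* Module.End ℤ (Pol n) :=
  RingQuot.lift ⟨(FreeAlgebra.lift ℤ polOp).toRingHom, fun _ _ h => lift_polOp_rel hn h⟩

theorem polRep_gen {n : ℕ} (hn : 2 ≤ n) (g : Gen n) : polRep hn (NH.gen g) = polOp g := by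
  have := RingQuot.lift_mkRingHom_apply (FreeAlgebra.lift ℤ polOp).toRingHom (r := NHRel n)
    (fun _ _ h => lift_polOp_rel hn h) (FreeAlgebra.ι ℤ g)
  exact this.trans (FreeAlgebra.lift_ι_apply _ _)

/-- The polynomial representation of `NH_{n,ℚ}`. -/
noncomputable def polRepQ {n : ℕ} (hn : 2 ≤ n) : NHQ n →ₐ[ℚ] Module.End ℚ (PolQ n) :=
  Algebra.TensorProduct.lift (Algebra.ofId ℚ _)
    ((Module.End.baseChangeHom ℤ ℚ (Pol n)).comp (polRep hn).toIntAlgHom)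
    (by
      intro c a
      rw [Algebra.ofId_apply]
      exact Algebra.commute_algebraMap_left c _)

theorem polRepQ_tmul {n : ℕ} (hn : 2 ≤ n) (c : ℚ) (a : NH n) (f : PolQ n) :
    polRepQ hn (c ⊗ₜ a) f = c • (polRep hn a).baseChange ℚ f := by
  rw [polRepQ, Algebra.TensorProduct.lift_tmul, Algebra.ofId_apply, ← Algebra.smul_def]
  rfl

theorem polRepQ_x {n : ℕ} (hn : 2 ≤ n) (i : Fin n) (f : PolQ n) :
    polRepQ hn (1 ⊗ₜ[ℤ] NH.gen (.x i)) f = (1 ⊗ₜ[ℤ] Pol.X i) * f := by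
  rw [polRepQ_tmul, one_smul, polRep_gen, polOp]
  induction f using TensorProduct.induction_on with
  | zero => simp
  | tmul c f => simp
  | add f g hf hg => rw [map_add, hf, hg, mul_add]

theorem polRepQ_d {n : ℕ} (hn : 2 ≤ n) (i : Fin n) (f : PolQ n) :
    polRepQ hn (1 ⊗ₜ[ℤ] NH.gen (.d i)) f = (dem i).baseChange ℚ f := by
  rw [polRepQ_tmul, one_smul, polRep_gen, polOp]

/-! ### Induction principles -/

theorem PolQ.induction {n : ℕ} {p : PolQ n → Prop} (h1 : p 1)
    (hX : ∀ i f, p f → p ((1 ⊗ₜ[ℤ] Pol.X i) * f)) (hadd : ∀ f g, p f → p g → p (f + g))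
    (hsmul : ∀ (c : ℚ) f, p f → p (c • f)) (f : PolQ n) : p f := by
  have key : ∀ (f : Pol n) (g : PolQ n), p g → p ((1 ⊗ₜ[ℤ] f) * g) := by
    intro f
    induction f using Pol.induction with
    | hX i => exact hX i
    | h1 =>
      intro g hg
      rwa [← Algebra.TensorProduct.one_def, one_mul]
    | hneg f hf =>
      intro g hg
      have : (1 : ℚ) ⊗ₜ[ℤ] (-f) = (-1 : ℚ) • ((1 : ℚ) ⊗ₜ[ℤ] f) := by
        rw [TensorProduct.tmul_neg, neg_one_smul]
      rw [this, smul_mul_assoc]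
      exact hsmul _ _ (hf g hg)
    | hadd f f' hf hf' =>
      intro g hg
      rw [TensorProduct.tmul_add, add_mul]
      exact hadd _ _ (hf g hg) (hf' g hg)
    | hmul f f' hf hf' =>
      intro g hg
      have : (1 : ℚ) ⊗ₜ[ℤ] (f * f') = (1 ⊗ₜ[ℤ] f) * (1 ⊗ₜ[ℤ] f') := by
        rw [Algebra.TensorProduct.tmul_mul_tmul, one_mul]
      rw [this, mul_assoc]
      exact hf _ (hf' _ hg)
  induction f using TensorProduct.induction_on with
  | zero => simpa using hsmul 0 _ h1
  | tmul c f =>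
    have := hsmul c _ (key f 1 h1)
    rwa [mul_one, TensorProduct.smul_tmul', smul_eq_mul, mul_one] at this
  | add f g hf hg => exact hadd _ _ hf hg

theorem NHQ.induction {n : ℕ} {p : NHQ n → Prop} (h1 : p 1)
    (hgen : ∀ g a, p a → p ((1 ⊗ₜ[ℤ] NH.gen g) * a)) (hadd : ∀ a b, p a → p b → p (a + b))
    (hsmul : ∀ (c : ℚ) a, p a → p (c • a)) (a : NHQ n) : p a := by
  have key : ∀ (a : FreeAlgebra ℤ (Gen n)) (b : NHQ n), p b → p ((1 ⊗ₜ[ℤ] NH.mk n a) * b) := by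
    intro a
    induction a using FreeAlgebra.induction with
    | grade0 r =>
      intro b hb
      have : (1 : ℚ) ⊗ₜ[ℤ] NH.mk n (algebraMap ℤ _ r) = (r : ℚ) • (1 : NHQ n) := by
        rw [eq_intCast (algebraMap ℤ (FreeAlgebra ℤ (Gen n))) r, map_intCast, ← zsmul_one,
          TensorProduct.tmul_smul, ← Algebra.TensorProduct.one_def, Int.cast_smul_eq_zsmul]
      rw [this, smul_mul_assoc, one_mul]
      exact hsmul _ _ hb
    | grade1 g => exact hgen g
    | mul a a' ha ha' =>
      intro b hb
      have : (1 : ℚ) ⊗ₜ[ℤ] NH.mk n (a * a') = (1 ⊗ₜ[ℤ] NH.mk n a) * (1 ⊗ₜ[ℤ] NH.mk n a') := by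
        rw [Algebra.TensorProduct.tmul_mul_tmul, one_mul, map_mul]
      rw [this, mul_assoc]
      exact ha _ (ha' _ hb)
    | add a a' ha ha' =>
      intro b hb
      rw [map_add, TensorProduct.tmul_add, add_mul]
      exact hadd _ _ (ha b hb) (ha' b hb)
  induction a using TensorProduct.induction_on with
  | zero => simpa using hsmul 0 _ h1
  | tmul c a =>
    obtain ⟨a, rfl⟩ := RingQuot.mkRingHom_surjective (NHRel n) a
    have := hsmul c _ (key a 1 h1)
    rwa [mul_one, TensorProduct.smul_tmul', smul_eq_mul, mul_one] at this
  | add a b ha hb => exact hadd _ _ ha hb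

/-! ### The polynomial action and the left regular action -/

/-- The polynomial representation, as an action. -/
noncomputable def polAction (N : ℕ) : SpinAction N (PolQ (N + 2)) :=
  .ofHom (polRepQ (Nat.le_add_left 2 N))

/-- The left regular representation, as an action. -/
noncomputable def regAction (N : ℕ) : SpinAction N (NHQ (N + 2)) :=
  .ofHom (Algebra.lmul ℚ (NHQ (N + 2)))

section Actions

variable {N : ℕ}

theorem polAction_x (i : Fin (N + 2)) (f : PolQ (N + 2)) :
    (polAction N).x i f = (1 ⊗ₜ[ℤ] Pol.X i) * f := by
  rw [← polRepQ_x (Nat.le_add_left 2 N)]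
  exact LinearMap.congr_fun (xOp_of_lt _ i.2) f

theorem polAction_d (i : Fin (N + 2)) (f : PolQ (N + 2)) :
    (polAction N).d i f = (dem i).baseChange ℚ f := by
  rw [← polRepQ_d (Nat.le_add_left 2 N)]
  exact LinearMap.congr_fun (dOp_of_lt _ i.2) f

theorem regAction_x (i : Fin (N + 2)) (a : NHQ (N + 2)) :
    (regAction N).x i a = (1 ⊗ₜ[ℤ] NH.gen (.x i)) * a :=
  LinearMap.congr_fun (xOp_of_lt _ i.2) a

theorem regAction_d (i : Fin (N + 2)) (a : NHQ (N + 2)) :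
    (regAction N).d i a = (1 ⊗ₜ[ℤ] NH.gen (.d i)) * a :=
  LinearMap.congr_fun (dOp_of_lt _ i.2) a

theorem polAction_x_of_ge {i : ℕ} (hi : N + 2 ≤ i) : (polAction N).x i = 0 :=
  dif_neg (by omega)

theorem polAction_d_one (i : ℕ) : (polAction N).d i 1 = 0 := by
  by_cases hi : i < N + 2
  · rw [polAction_d ⟨i, hi⟩, Algebra.TensorProduct.one_def, LinearMap.baseChange_tmul, dem_one,
      TensorProduct.tmul_zero]
  · have : (polAction N).d i = 0 := dif_neg hi
    rw [this, LinearMap.zero_apply]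

theorem polAction_x_mul (i : ℕ) (f g : PolQ (N + 2)) :
    (polAction N).x i (f * g) = (polAction N).x i f * g := by
  by_cases hi : i < N + 2
  · rw [polAction_x ⟨i, hi⟩, polAction_x ⟨i, hi⟩, mul_assoc]
  · rw [polAction_x_of_ge (by omega), LinearMap.zero_apply, LinearMap.zero_apply, zero_mul]

theorem polAction_word_mul (l : List ℕ) (f g : PolQ (N + 2)) :
    (polAction N).word l (f * g) = (polAction N).word l f * g := by
  induction l with
  | nil => rfl
  | cons i l ih => rw [SpinAction.word_cons, ih, polAction_x_mul, SpinAction.word_cons]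

/-- The uniform shape of the relations between the variables and the `∂_j`. -/
theorem SpinAction.exists_d_x {i j : ℕ} (hi : i ≤ N + 1) (hj : j ≤ N + 1) :
    ∃ (c e : ℚ) (k : ℕ), k ≤ N + 1 ∧ ∀ (M : Type) [AddCommGroup M] [Module ℚ M]
      (A : SpinAction N M) (m : M), A.d j (A.x i m) = c • m + e • A.x k (A.d j m) := by
  rcases hj.eq_or_lt with rfl | hj
  · by_cases h1 : i = N
    · exact ⟨1, 1, N + 1, le_rfl, fun M _ _ A m => by
        rw [h1, A.dxD, one_smul, one_smul]⟩
    by_cases h2 : i = N + 1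
    · exact ⟨-1, 1, N, by omega, fun M _ _ A m => by
        rw [h2, A.xdD, one_smul, neg_one_smul, sub_eq_neg_add]⟩
    · exact ⟨0, -1, i, hi, fun M _ _ A m => by
        rw [A.dxFarD i (by omega), zero_smul, zero_add, neg_one_smul]⟩
  · by_cases h1 : i = j
    · exact ⟨1, -1, j + 1, hj, fun M _ _ A m => by
        rw [h1, A.dx j (by omega), one_smul, neg_one_smul, sub_eq_add_neg]⟩
    by_cases h2 : i = j + 1
    · exact ⟨1, -1, j, by omega, fun M _ _ A m => by
        rw [h2, A.xd j (by omega), one_smul, neg_one_smul, sub_eq_add_neg]⟩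
    · exact ⟨0, -1, i, hi, fun M _ _ A m => by
        rw [A.dxFar j i (by omega) hi h1 h2, zero_smul, zero_add, neg_one_smul]⟩

/-- A family of linear maps out of the skew-polynomial ring that is compatible with the variables is
compatible with the `∂_j`, if the images of `1` are killed by the `∂_j`. The index of the family
records the degree. -/
theorem map_polAction_d {M : Type} [AddCommGroup M] [Module ℚ M] {B : SpinAction N M}
    {F : ℤ → PolQ (N + 2) →ₗ[ℚ] M}
    (hx : ∀ k, ∀ i ≤ N + 1, ∀ f, F (k + 2) ((polAction N).x i f) = B.x i (F k f))
    (h1 : ∀ k, ∀ j ≤ N + 1, B.d j (F k 1) = 0) {j : ℕ} (hj : j ≤ N + 1) (f : PolQ (N + 2)) :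
    ∀ k, F k ((polAction N).d j f) = B.d j (F (k + 2) f) := by
  induction f using PolQ.induction with
  | h1 =>
    intro k
    rw [polAction_d_one, map_zero, h1 _ j hj]
  | hX i f ih =>
    intro k
    rw [← polAction_x]
    obtain ⟨c, e, l, hl, h⟩ := SpinAction.exists_d_x (N := N) (i := i) (by omega) hj
    rw [hx k i (by omega), h _ B, h _ (polAction N), map_add, map_smul, map_smul]
    have h2 := hx (k - 2) l hl ((polAction N).d j f)
    rw [ih, sub_add_cancel] at h2
    rw [h2]
  | hadd f g hf hg =>
    intro k
    rw [map_add, map_add, map_add, map_add, hf, hg]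
  | hsmul c f hf =>
    intro k
    rw [map_smul, map_smul, map_smul, map_smul, hf]

end Actions

/-! ### The homogeneous components of a skew polynomial -/

section Grading

open LaurentPolynomial

variable {n : ℕ}

/-- The ring homomorphism that multiplies a skew polynomial of degree `k` by `T^k`,
where the variables have degree `2`. -/
noncomputable def gradingHom (n : ℕ) : Pol n →+* LaurentPolynomial (Pol n) :=
  Pol.lift (fun i => C (Pol.X i) * T 2) (by
    intro i j h
    have h1 : ∀ a b : Pol n, (C a * T 2) * (C b * T 2) = (C (a * b) * T 4 : (Pol n)[T;T⁻¹]) := by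
      intro a b
      rw [mul_assoc, ← mul_assoc (T 2), T_mul, map_mul, mul_assoc, mul_assoc, ← T_add]
      norm_num
    rw [h1, h1, ← add_mul, ← map_add, Pol.anti h, map_zero, zero_mul])

/-- The component of degree `k`. -/
noncomputable def component (n : ℕ) (k : ℤ) : Pol n →ₗ[ℤ] Pol n :=
  AddMonoidHom.toIntLinearMap
    { toFun := fun f => (gradingHom n f).coeff k
      map_zero' := by simp
      map_add' := by simp }

theorem component_X_mul (k : ℤ) (i : Fin n) (f : Pol n) :
    component n (k + 2) (Pol.X i * f) = Pol.X i * component n k f := by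
  change (gradingHom n (Pol.X i * f)).coeff (k + 2) = Pol.X i * (gradingHom n f).coeff k
  rw [map_mul, gradingHom, Pol.lift_X, ← single_eq_C_mul_T,
    AddMonoidAlgebra.coeff_single_mul_apply, add_comm k, neg_add_cancel_left]

theorem component_one (k : ℤ) : component n k 1 = if k = 0 then 1 else 0 := by
  change (gradingHom n 1).coeff k = _
  rw [map_one, AddMonoidAlgebra.one_def, AddMonoidAlgebra.coeff_single,
    Finsupp.single_apply]
  simp only [eq_comm]

/-- The component of degree `k` of a skew polynomial with rational coefficients. -/
noncomputable def componentQ (n : ℕ) (k : ℤ) : PolQ n →ₗ[ℚ] PolQ n :=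
  (component n k).baseChange ℚ

theorem componentQ_X_mul (k : ℤ) (i : Fin n) (f : PolQ n) :
    componentQ n (k + 2) ((1 ⊗ₜ[ℤ] Pol.X i) * f) = (1 ⊗ₜ[ℤ] Pol.X i) * componentQ n k f := by
  induction f using TensorProduct.induction_on with
  | zero => simp
  | tmul c f =>
    rw [Algebra.TensorProduct.tmul_mul_tmul, componentQ, componentQ, LinearMap.baseChange_tmul,
      LinearMap.baseChange_tmul, Algebra.TensorProduct.tmul_mul_tmul, component_X_mul]
  | add f g hf hg => rw [mul_add, map_add, map_add, hf, hg, mul_add]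

theorem componentQ_one (k : ℤ) : componentQ n k 1 = if k = 0 then 1 else 0 := by
  rw [Algebra.TensorProduct.one_def, componentQ, LinearMap.baseChange_tmul, component_one]
  split_ifs <;> simp

theorem PolQ.one_mem_degree : (1 : PolQ n) ∈ PolQ.degree n 0 :=
  Submodule.subset_span ⟨[], by simp, by simp [Algebra.TensorProduct.one_def]⟩

theorem PolQ.mul_mem_degree {j k : ℤ} {f g : PolQ n} (hf : f ∈ PolQ.degree n j)
    (hg : g ∈ PolQ.degree n k) : f * g ∈ PolQ.degree n (j + k) := by
  induction hf, hg using Submodule.span_induction₂ with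
  | mem_mem f g hf hg =>
    obtain ⟨l, rfl, rfl⟩ := hf
    obtain ⟨l', rfl, rfl⟩ := hg
    refine Submodule.subset_span ⟨l ++ l', ?_, ?_⟩
    · rw [List.length_append]
      push_cast
      ring
    · rw [List.map_append, List.prod_append, Algebra.TensorProduct.tmul_mul_tmul, one_mul]
  | zero_left g hg => simp
  | zero_right f hf => simp
  | add_left f f' g _ _ _ h h' => rw [add_mul]; exact add_mem h h'
  | add_right f g g' _ _ _ h h' => rw [mul_add]; exact add_mem h h'
  | smul_left c f g _ _ h => rw [smul_mul_assoc]; exact Submodule.smul_mem _ c h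
  | smul_right c f g _ _ h => rw [mul_smul_comm]; exact Submodule.smul_mem _ c h

theorem PolQ.X_mem_degree (i : Fin n) : (1 ⊗ₜ[ℤ] Pol.X i : PolQ n) ∈ PolQ.degree n 2 :=
  Submodule.subset_span ⟨[i], by simp, by simp⟩

theorem PolQ.X_mul_mem_degree {k : ℤ} (i : Fin n) {f : PolQ n} (hf : f ∈ PolQ.degree n k) :
    (1 ⊗ₜ[ℤ] Pol.X i) * f ∈ PolQ.degree n (k + 2) := by
  rw [add_comm]
  exact mul_mem_degree (X_mem_degree i) hf

theorem componentQ_mem (f : PolQ n) : ∀ k, componentQ n k f ∈ PolQ.degree n k := by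
  induction f using PolQ.induction with
  | h1 =>
    intro k
    rw [componentQ_one]
    split_ifs with h
    · rw [h]
      exact PolQ.one_mem_degree
    · exact zero_mem _
  | hX i f ih =>
    intro k
    rw [← sub_add_cancel k 2, componentQ_X_mul]
    exact PolQ.X_mul_mem_degree i (ih _)
  | hadd f g hf hg =>
    intro k
    rw [map_add]
    exact add_mem (hf k) (hg k)
  | hsmul c f hf =>
    intro k
    rw [map_smul]
    exact Submodule.smul_mem _ c (hf k)

theorem componentQ_of_mem {j : ℤ} {f : PolQ n} (hf : f ∈ PolQ.degree n j) (k : ℤ) :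
    componentQ n k f = if k = j then f else 0 := by
  induction hf using Submodule.span_induction with
  | mem f hf =>
    obtain ⟨l, rfl, rfl⟩ := hf
    induction l generalizing k with
    | nil =>
      rw [List.map_nil, List.prod_nil, ← Algebra.TensorProduct.one_def, componentQ_one]
      simp
    | cons i l ih =>
      have h : (1 ⊗ₜ[ℤ] ((i :: l).map Pol.X).prod : PolQ n) =
          (1 ⊗ₜ[ℤ] Pol.X i) * (1 ⊗ₜ[ℤ] (l.map Pol.X).prod) := by
        rw [List.map_cons, List.prod_cons, Algebra.TensorProduct.tmul_mul_tmul, one_mul]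
      rw [h]
      nth_rewrite 1 [← sub_add_cancel k 2]
      rw [componentQ_X_mul, ih, mul_ite, mul_zero, List.length_cons]
      refine if_congr ?_ rfl rfl
      push_cast
      constructor <;> intro h <;> linarith
  | zero => simp
  | add f g _ _ hf hg =>
    rw [map_add, hf, hg]
    split_ifs <;> simp
  | smul c f _ hf =>
    rw [map_smul, hf]
    split_ifs <;> simp

/-- Linear maps that agree on the homogeneous skew polynomials are equal. -/
theorem PolQ.ext_degree {M : Type} [AddCommGroup M] [Module ℚ M] {S T : PolQ n →ₗ[ℚ] M}
    (h : ∀ k, ∀ f ∈ PolQ.degree n k, S f = T f) : S = T := by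
  have key : ∀ f : PolQ n, f ∈ ⨆ k, PolQ.degree n k := by
    intro f
    induction f using PolQ.induction with
    | h1 => exact Submodule.mem_iSup_of_mem 0 PolQ.one_mem_degree
    | hX i f ih =>
      induction ih using Submodule.iSup_induction' with
      | mem k f hf => exact Submodule.mem_iSup_of_mem (k + 2) (PolQ.X_mul_mem_degree i hf)
      | zero => simp
      | add f g _ _ hf hg => rw [mul_add]; exact add_mem hf hg
    | hadd f g hf hg => exact add_mem hf hg
    | hsmul c f hf => exact Submodule.smul_mem _ c hf
  refine LinearMap.ext fun f => ?_
  induction key f using Submodule.iSup_induction' with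
  | mem k f hf => exact h k f hf
  | zero => rw [map_zero, map_zero]
  | add f g _ _ hf hg => rw [map_add, map_add, hf, hg]

end Grading

/-! ### The base change of the ring of symmetric polynomials -/

section Lam

variable {n : ℕ}

/-- The inclusion of `Λ_n`, as a linear map. -/
def lamSubtype (n : ℕ) : Lam n →ₗ[ℤ] Pol n := (Lam n).subtype.toIntAlgHom.toLinearMap

theorem incl_injective (n : ℕ) : Function.Injective (incl n) :=
  Module.Flat.lTensor_preserves_injective_linearMap (M := ℚ) (lamSubtype n)
    Subtype.val_injective

/-- Since `ℚ` is flat over `ℤ`, the ring `Λ_{n,ℚ}` is the common kernel of the operators after base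
change. -/
theorem exists_incl_eq {f : PolQ n} (hf : ∀ i, (dem i).baseChange ℚ f = 0) :
    ∃ g, incl n g = f := by
  have hexact : Function.Exact (lamSubtype n) (LinearMap.pi fun i : Fin n => dem i) := by
    intro f
    constructor
    · exact fun h => ⟨⟨f, fun i => congrFun h i⟩, rfl⟩
    · rintro ⟨g, rfl⟩
      exact funext g.2
  refine (Module.Flat.lTensor_exact ℚ hexact f).1 ?_
  refine (TensorProduct.piRight ℤ ℚ ℚ fun _ : Fin n => Pol n).injective ?_
  rw [map_zero]
  refine Eq.trans ?_ (funext hf)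
  clear hf
  induction f using TensorProduct.induction_on with
  | zero => ext; simp
  | tmul c f => ext i; simp
  | add f g hf hg =>
    rw [map_add, map_add, hf, hg]
    ext i
    simp

theorem dem_incl (i : Fin n) (g : LamQ n) : (dem i).baseChange ℚ (incl n g) = 0 := by
  induction g using TensorProduct.induction_on with
  | zero => simp
  | tmul c g =>
    have : dem i (g : Pol n) = 0 := g.2 i
    simp [incl, this]
  | add f g hf hg => rw [map_add, map_add, hf, hg, add_zero]

end Lam

section Polynomial

variable {N : ℕ}

theorem SpinAction.mem_inv_zero {M : Type} [AddCommGroup M] [Module ℚ M] {A : SpinAction N M}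
    {m : M} : m ∈ A.inv 0 ↔ ∀ j ≤ N + 1, A.d j m = 0 :=
  ⟨fun h j hj => h (Nat.zero_le _) j (Nat.zero_le _) hj, fun h _ j _ hj => h j hj⟩

theorem mem_inv_iff_exists_incl {f : PolQ (N + 2)} :
    f ∈ (polAction N).inv 0 ↔ ∃ g, incl (N + 2) g = f := by
  rw [SpinAction.mem_inv_zero]
  constructor
  · intro h
    refine exists_incl_eq fun i => ?_
    rw [← polAction_d]
    exact h i (by omega)
  · rintro ⟨g, rfl⟩ j hj
    rw [show j = ((⟨j, by omega⟩ : Fin (N + 2)) : ℕ) from rfl, polAction_d, dem_incl]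

theorem polAction_d_mul_incl {j : ℕ} (hj : j ≤ N + 1) (f : PolQ (N + 2)) (g : LamQ (N + 2)) :
    (polAction N).d j (f * incl _ g) = (polAction N).d j f * incl _ g := by
  have hg := SpinAction.mem_inv_zero.1 (mem_inv_iff_exists_incl.2 ⟨g, rfl⟩)
  refine (map_polAction_d (B := polAction N) (F := fun _ => LinearMap.mulRight ℚ (incl _ g))
    (fun _ i _ f => ?_) (fun _ j hj => ?_) hj f 0).symm
  · simp [polAction_x_mul]
  · simpa using hg j hj

theorem componentQ_d {j : ℕ} (hj : j ≤ N + 1) (k : ℤ) (f : PolQ (N + 2)) :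
    componentQ _ k ((polAction N).d j f) = (polAction N).d j (componentQ _ (k + 2) f) := by
  refine map_polAction_d (B := polAction N) (F := componentQ _) (fun k i hi f => ?_)
    (fun k j _ => ?_) hj f k
  · rw [show i = ((⟨i, by omega⟩ : Fin (N + 2)) : ℕ) from rfl, polAction_x, polAction_x,
      componentQ_X_mul]
  · rw [componentQ_one]
    split_ifs
    · exact polAction_d_one j
    · exact map_zero _

theorem componentQ_mem_inv {f : PolQ (N + 2)} (hf : f ∈ (polAction N).inv 0) (k : ℤ) :
    componentQ _ k f ∈ (polAction N).inv 0 := by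
  rw [SpinAction.mem_inv_zero] at hf ⊢
  intro j hj
  rw [← sub_add_cancel k 2, ← componentQ_d hj, hf j hj, map_zero]

theorem componentQ_word (l : List ℕ) (k : ℤ) (f : PolQ (N + 2)) :
    componentQ _ k ((polAction N).word l f) =
      (polAction N).word l (componentQ _ (k - 2 * l.length) f) := by
  induction l generalizing k with
  | nil => simp [SpinAction.word_nil]
  | cons i l ih =>
    rw [SpinAction.word_cons, SpinAction.word_cons]
    by_cases hi : i < N + 2
    · rw [show i = ((⟨i, hi⟩ : Fin (N + 2)) : ℕ) from rfl, polAction_x, polAction_x]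
      nth_rewrite 1 [← sub_add_cancel k 2]
      rw [componentQ_X_mul, ih, List.length_cons]
      congr 4
      push_cast
      ring
    · rw [polAction_x_of_ge (by omega), LinearMap.zero_apply, LinearMap.zero_apply, map_zero]

theorem word_one_mem_degree (l : List ℕ) :
    (polAction N).word l 1 ∈ PolQ.degree (N + 2) (2 * (l.length : ℤ)) := by
  have h := componentQ_word (N := N) l (2 * l.length) 1
  rw [sub_self, componentQ_one, if_pos rfl] at h
  rw [← h]
  exact componentQ_mem _ _

theorem componentQ_gen (g : Gen (N + 2)) (k : ℤ) (f : PolQ (N + 2)) :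
    componentQ _ (k + g.deg) (polRepQ (Nat.le_add_left 2 N) (1 ⊗ₜ[ℤ] NH.gen g) f) =
      polRepQ (Nat.le_add_left 2 N) (1 ⊗ₜ[ℤ] NH.gen g) (componentQ _ k f) := by
  cases g with
  | x i => rw [polRepQ_x, polRepQ_x, Gen.deg, componentQ_X_mul]
  | d i =>
    rw [polRepQ_d, polRepQ_d, Gen.deg, ← polAction_d, ← polAction_d, componentQ_d (by omega),
      neg_add_cancel_right]

/-! ### The action on the module over the symmetric polynomials -/

theorem polRepQ_mul_incl (a : NHQ (N + 2)) (g : LamQ (N + 2)) : ∀ f : PolQ (N + 2),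
    polRepQ (Nat.le_add_left 2 N) a (f * incl _ g) =
      polRepQ (Nat.le_add_left 2 N) a f * incl _ g := by
  induction a using NHQ.induction with
  | h1 => simp
  | hgen x a ih =>
    intro f
    rw [map_mul (polRepQ (Nat.le_add_left 2 N)), Module.End.mul_apply, Module.End.mul_apply, ih]
    cases x with
    | x i => rw [polRepQ_x, polRepQ_x, mul_assoc]
    | d i => rw [polRepQ_d, polRepQ_d, ← polAction_d, ← polAction_d,
        polAction_d_mul_incl (by omega)]
  | hadd a b ha hb =>
    intro f
    rw [map_add, LinearMap.add_apply, LinearMap.add_apply, ha, hb, add_mul]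
  | hsmul c a ha =>
    intro f
    rw [map_smul, LinearMap.smul_apply, LinearMap.smul_apply, ha, smul_mul_assoc]

/-- The homomorphism from the nilHecke algebra to the endomorphism algebra. -/
noncomputable def actHom (N : ℕ) : NHQ (N + 2) →ₐ[ℚ] EndQ (N + 2) where
  toFun a :=
    { toFun := polRepQ (Nat.le_add_left 2 N) a
      map_add' := map_add _
      map_smul' := fun g f => by
        induction g using MulOpposite.rec' with
        | _ g => exact polRepQ_mul_incl a g f }
  map_one' := LinearMap.ext fun f => by simp
  map_mul' a b := LinearMap.ext fun f => by simp
  map_zero' := LinearMap.ext fun f => by simp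
  map_add' a b := LinearMap.ext fun f => by simp
  commutes' c := LinearMap.ext fun f =>
    LinearMap.congr_fun ((polRepQ (Nat.le_add_left 2 N)).commutes c) f

theorem actHom_apply (a : NHQ (N + 2)) (f : PolQ (N + 2)) :
    actHom N a f = polRepQ (Nat.le_add_left 2 N) a f := rfl

theorem EndQ.map_mul_incl {n : ℕ} (T : EndQ n) (f : PolQ n) (g : LamQ n) :
    T (f * incl n g) = T f * incl n g :=
  T.map_smul (MulOpposite.op g) f

theorem NH.gen_x_anti {n : ℕ} {i j : Fin n} (h : i ≠ j) :
    NH.gen (Gen.x i) * NH.gen (Gen.x j) + NH.gen (Gen.x j) * NH.gen (Gen.x i) = 0 := by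
  have := RingQuot.mkRingHom_rel (NHRel.anti i j h)
  rw [map_add, map_mul, map_mul, map_zero] at this
  exact this

/-- The homomorphism from the skew-polynomial ring to the nilHecke algebra that sends `x_i` to
`x_i`. -/
noncomputable def polToNH (n : ℕ) : PolQ n →ₐ[ℚ] NHQ n :=
  Algebra.TensorProduct.map (AlgHom.id ℚ ℚ)
    (Pol.lift (fun i => NH.gen (Gen.x i)) fun _ _ => NH.gen_x_anti).toIntAlgHom

theorem polToNH_X {n : ℕ} (i : Fin n) :
    polToNH n (1 ⊗ₜ[ℤ] Pol.X i) = 1 ⊗ₜ[ℤ] NH.gen (Gen.x i) :=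
  congrArg (fun a => (1 : ℚ) ⊗ₜ[ℤ] a) (Pol.lift_X _ (fun _ _ => NH.gen_x_anti) i)

theorem actHom_polToNH (p f : PolQ (N + 2)) : actHom N (polToNH _ p) f = p * f := by
  induction p using PolQ.induction generalizing f with
  | h1 => simp
  | hX i p ih =>
    rw [map_mul, map_mul, Module.End.mul_apply, ih, polToNH_X, actHom_apply, polRepQ_x, mul_assoc]
  | hadd p q hp hq => rw [map_add, map_add, LinearMap.add_apply, hp, hq, add_mul]
  | hsmul c p hp => rw [map_smul, map_smul, LinearMap.smul_apply, hp, smul_mul_assoc]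

/-- If `m` is killed by all `∂_j`, then `NH · m` is a quotient of the polynomial representation. -/
theorem mul_polToNH_mul {m : NHQ (N + 2)} (hm : m ∈ (regAction N).inv 0) (a : NHQ (N + 2)) :
    ∀ p, a * (polToNH _ p * m) = polToNH _ (actHom N a p) * m := by
  rw [SpinAction.mem_inv_zero] at hm
  induction a using NHQ.induction with
  | h1 => simp
  | hgen g a ih =>
    intro p
    rw [mul_assoc, ih, map_mul, Module.End.mul_apply]
    generalize actHom N a p = q
    rw [actHom_apply]
    cases g with
    | x i => rw [polRepQ_x, map_mul, polToNH_X, mul_assoc]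
    | d i =>
      rw [polRepQ_d, ← polAction_d, ← regAction_d]
      refine (map_polAction_d (B := regAction N)
        (F := fun _ => LinearMap.mulRight ℚ m ∘ₗ (polToNH _).toLinearMap)
        (fun _ i hi f => ?_) (fun _ j hj => ?_) (by omega) q 0).symm
      · rw [show i = ((⟨i, by omega⟩ : Fin (N + 2)) : ℕ) from rfl, polAction_x, regAction_x]
        simp [polToNH_X, mul_assoc]
      · simpa using hm j hj
  | hadd a b ha hb =>
    intro p
    rw [add_mul, ha, hb, map_add, LinearMap.add_apply, map_add, add_mul]
  | hsmul c a ha =>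
    intro p
    rw [smul_mul_assoc, ha, map_smul, LinearMap.smul_apply, map_smul, smul_mul_assoc]

theorem regAction_word (l : List ℕ) (m : NHQ (N + 2)) :
    (regAction N).word l m = polToNH _ ((polAction N).word l 1) * m := by
  induction l with
  | nil => simp [SpinAction.word_nil]
  | cons i l ih =>
    rw [SpinAction.word_cons, ih, SpinAction.word_cons]
    by_cases hi : i < N + 2
    · rw [show i = ((⟨i, hi⟩ : Fin (N + 2)) : ℕ) from rfl, polAction_x, regAction_x, map_mul,
        polToNH_X, mul_assoc]
    · have h1 : (regAction N).x i = 0 := dif_neg hi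
      rw [polAction_x_of_ge (by omega), h1, LinearMap.zero_apply, LinearMap.zero_apply, map_zero,
        zero_mul]

theorem actHom_mem_inv {m : NHQ (N + 2)} (hm : m ∈ (regAction N).inv 0) (f : PolQ (N + 2)) :
    actHom N m f ∈ (polAction N).inv 0 := by
  rw [SpinAction.mem_inv_zero] at hm ⊢
  intro j hj
  have h := hm j hj
  rw [show j = ((⟨j, by omega⟩ : Fin (N + 2)) : ℕ) from rfl, regAction_d] at h
  rw [show j = ((⟨j, by omega⟩ : Fin (N + 2)) : ℕ) from rfl, polAction_d,
    ← polRepQ_d (Nat.le_add_left 2 N), ← actHom_apply, ← Module.End.mul_apply, ← map_mul, h,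
    map_zero, LinearMap.zero_apply]

/-- A decomposition of the left regular representation writes `1` as a sum of products `u_i m_i` of
polynomials `u_i` with elements `m_i` that are killed by all `∂_j` from the left. Then `a` is
recovered from its action as the sum of the `a(u_i) m_i`. -/
theorem actHom_bijective {ι : Type} [Fintype ι] {w : ι → List ℕ}
    (h : Decomposes ⊤ ((regAction N).inv 0) fun i => (regAction N).word (w i)) :
    Function.Bijective (actHom N) := by
  obtain ⟨m, hm, h1⟩ := h.exists_sum 1 trivial
  simp only [regAction_word] at h1
  constructor
  · refine (injective_iff_map_eq_zero _).2 fun a ha => ?_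
    rw [← mul_one a, h1, Finset.mul_sum]
    refine Finset.sum_eq_zero fun i _ => ?_
    rw [mul_polToNH_mul (hm i), ha, LinearMap.zero_apply, map_zero, zero_mul]
  · intro T
    refine ⟨∑ i, polToNH _ (T ((polAction N).word (w i) 1)) * m i, LinearMap.ext fun f => ?_⟩
    have hf : f = ∑ i, (polAction N).word (w i) 1 * actHom N (m i) f := by
      have := LinearMap.congr_fun (congrArg (actHom N) h1) f
      rw [map_one, Module.End.one_apply, map_sum, LinearMap.sum_apply] at this
      refine this.trans (Finset.sum_congr rfl fun i _ => ?_)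
      rw [map_mul, Module.End.mul_apply, actHom_polToNH]
    conv_rhs => rw [hf, map_sum]
    rw [map_sum, LinearMap.sum_apply]
    refine Finset.sum_congr rfl fun i _ => ?_
    obtain ⟨g, hg⟩ := mem_inv_iff_exists_incl.1 (actHom_mem_inv (hm i) f)
    rw [map_mul, Module.End.mul_apply, actHom_polToNH, ← hg, EndQ.map_mul_incl]

/-! ### The gradings -/

theorem actHom_gen_mem_degree (g : Gen (N + 2)) :
    actHom N (1 ⊗ₜ[ℤ] NH.gen g) ∈ EndQ.degree (N + 2) g.deg := by
  intro j f hf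
  have h := componentQ_gen g j f
  rw [componentQ_of_mem hf, if_pos rfl] at h
  rw [actHom_apply, ← h]
  exact componentQ_mem _ _

theorem EndQ.mul_mem_degree {n : ℕ} {j k : ℤ} {S T : EndQ n} (hS : S ∈ EndQ.degree n j)
    (hT : T ∈ EndQ.degree n k) : S * T ∈ EndQ.degree n (j + k) := by
  intro i f hf
  have := hS _ _ (hT _ _ hf)
  rwa [add_assoc, add_comm k] at this

theorem actHom_mem_degree {k : ℤ} {a : NHQ (N + 2)} (ha : a ∈ NHQ.degree (N + 2) k) :
    actHom N a ∈ EndQ.degree (N + 2) k := by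
  induction ha using Submodule.span_induction with
  | mem a ha =>
    obtain ⟨l, rfl, rfl⟩ := ha
    induction l with
    | nil =>
      rw [List.map_nil, List.map_nil, List.prod_nil, ← Algebra.TensorProduct.one_def, map_one]
      intro j f hf
      simpa using hf
    | cons g l ih =>
      have h : (1 ⊗ₜ[ℤ] ((g :: l).map NH.gen).prod : NHQ (N + 2)) =
          (1 ⊗ₜ[ℤ] NH.gen g) * (1 ⊗ₜ[ℤ] (l.map NH.gen).prod) := by
        rw [List.map_cons, List.prod_cons, Algebra.TensorProduct.tmul_mul_tmul, one_mul]
      rw [h, map_mul, List.map_cons, List.sum_cons]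
      exact EndQ.mul_mem_degree (actHom_gen_mem_degree g) ih
  | zero => rw [map_zero]; exact zero_mem _
  | add a b _ _ ha hb => rw [map_add]; exact add_mem ha hb
  | smul c a _ ha => rw [map_smul]; exact Submodule.smul_mem _ c ha

theorem NHQ.gen_mul_mem_degree {n : ℕ} (g : Gen n) {k : ℤ} {a : NHQ n}
    (ha : a ∈ NHQ.degree n k) : (1 ⊗ₜ[ℤ] NH.gen g) * a ∈ NHQ.degree n (k + g.deg) := by
  induction ha using Submodule.span_induction with
  | mem a ha =>
    obtain ⟨l, rfl, rfl⟩ := ha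
    refine Submodule.subset_span ⟨g :: l, ?_, ?_⟩
    · rw [List.map_cons, List.sum_cons, add_comm]
    · rw [List.map_cons, List.prod_cons, Algebra.TensorProduct.tmul_mul_tmul, one_mul]
  | zero => rw [mul_zero]; exact zero_mem _
  | add a b _ _ ha hb => rw [mul_add]; exact add_mem ha hb
  | smul c a _ ha => rw [mul_smul_comm]; exact Submodule.smul_mem _ c ha

/-- Every element of the nilHecke algebra has a component of degree `k`, which acts by the component
of degree `k` of its action. -/
theorem exists_degree_component (a : NHQ (N + 2)) : ∀ k, ∃ b ∈ NHQ.degree (N + 2) k,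
    ∀ j, ∀ f ∈ PolQ.degree (N + 2) j, componentQ _ (j + k) (actHom N a f) = actHom N b f := by
  induction a using NHQ.induction with
  | h1 =>
    intro k
    by_cases hk : k = 0
    · refine ⟨1, Submodule.subset_span ⟨[], by simp [hk], ?_⟩, fun j f hf => ?_⟩
      · simp [Algebra.TensorProduct.one_def]
      · rw [map_one, Module.End.one_apply, componentQ_of_mem hf, if_pos (by omega)]
    · refine ⟨0, zero_mem _, fun j f hf => ?_⟩
      rw [map_one, map_zero, Module.End.one_apply, componentQ_of_mem hf, if_neg (by omega),
        LinearMap.zero_apply]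
  | hgen g a ih =>
    intro k
    obtain ⟨b, hb, h⟩ := ih (k - g.deg)
    refine ⟨(1 ⊗ₜ[ℤ] NH.gen g) * b, ?_, fun j f hf => ?_⟩
    · have := NHQ.gen_mul_mem_degree g hb
      rwa [sub_add_cancel] at this
    · rw [map_mul, map_mul, Module.End.mul_apply, Module.End.mul_apply, ← h j f hf,
        actHom_apply (1 ⊗ₜ[ℤ] NH.gen g), actHom_apply (1 ⊗ₜ[ℤ] NH.gen g), ← componentQ_gen]
      congr 2
      ring
  | hadd a a' ha ha' =>
    intro k
    obtain ⟨b, hb, h⟩ := ha k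
    obtain ⟨b', hb', h'⟩ := ha' k
    refine ⟨b + b', add_mem hb hb', fun j f hf => ?_⟩
    rw [map_add, map_add, LinearMap.add_apply, LinearMap.add_apply, map_add, h j f hf, h' j f hf]
  | hsmul c a ha =>
    intro k
    obtain ⟨b, hb, h⟩ := ha k
    refine ⟨c • b, Submodule.smul_mem _ c hb, fun j f hf => ?_⟩
    rw [map_smul, map_smul, LinearMap.smul_apply, LinearMap.smul_apply, map_smul, h j f hf]

theorem mem_degree_iff (hinj : Function.Injective (actHom N)) (k : ℤ) (a : NHQ (N + 2)) :
    a ∈ NHQ.degree (N + 2) k ↔ actHom N a ∈ EndQ.degree (N + 2) k := by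
  refine ⟨actHom_mem_degree, fun ha => ?_⟩
  obtain ⟨b, hb, h⟩ := exists_degree_component a k
  suffices hab : actHom N a = actHom N b by rwa [hinj hab]
  have : (actHom N a).restrictScalars ℚ = (actHom N b).restrictScalars ℚ := by
    refine PolQ.ext_degree fun j f hf => ?_
    change actHom N a f = actHom N b f
    rw [← h j f hf, componentQ_of_mem (ha j f hf), if_pos rfl]
  exact LinearMap.ext fun f => LinearMap.congr_fun this f

end Polynomial

/-! ### The Weyl group -/

/-- The signed permutation with a given underlying permutation and given signs. -/
def signedPerm {n : ℕ} (σ : Equiv.Perm (Fin n)) (s : Fin n → ℤˣ) : Equiv.Perm (Fin n × ℤˣ) where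
  toFun p := (σ p.1, p.2 * s p.1)
  invFun p := (σ.symm p.1, p.2 * s (σ.symm p.1))
  left_inv p := by simp [mul_assoc]
  right_inv p := by simp [mul_assoc]

theorem card_weylD (k : ℕ) : Fintype.card (WeylD (k + 1)) = 2 ^ k * (k + 1).factorial := by
  -- The sign of the first element is determined by the other signs.
  let s : (Fin k → ℤˣ) → Fin (k + 1) → ℤˣ := fun t => Fin.cons (∏ i, t i) t
  have hs : ∀ t, ∏ i, s t i = 1 := fun t => by
    rw [Fin.prod_univ_succ]
    simp [s]
  let F : Equiv.Perm (Fin (k + 1)) × (Fin k → ℤˣ) → WeylD (k + 1) := fun p =>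
    ⟨signedPerm p.1 (s p.2), fun i ε => by simp [signedPerm], by simpa [signedPerm] using hs p.2⟩
  have hF : Function.Bijective F := by
    constructor
    · rintro ⟨σ, t⟩ ⟨σ', t'⟩ h
      have h1 : ∀ i, (σ i, s t i) = (σ' i, s t' i) := fun i => by
        have := Equiv.congr_fun (congrArg Subtype.val h) (i, 1)
        simpa [F, signedPerm] using this
      refine Prod.ext (Equiv.ext fun i => (Prod.ext_iff.1 (h1 i)).1) (funext fun i => ?_)
      simpa [s] using (Prod.ext_iff.1 (h1 i.succ)).2
    · rintro ⟨w, hw, hw'⟩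
      have hinj : Function.Injective fun i => (w (i, 1)).1 := by
        intro i j hij
        have h1 := hw i (w (i, 1)).2
        have h2 := hw j (w (j, 1)).2
        rw [Int.units_mul_self] at h1 h2
        have h3 := w.injective (h1.trans ((congrArg (fun k => (k, (1 : ℤˣ))) hij).trans h2.symm))
        exact congrArg Prod.fst h3
      refine ⟨(Equiv.ofBijective _ (Finite.injective_iff_bijective.1 hinj),
        fun i => (w (i.succ, 1)).2), Subtype.ext (Equiv.ext fun p => ?_)⟩
      have h0 : s (fun i => (w (i.succ, 1)).2) = fun i => (w (i, 1)).2 := by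
        funext i
        refine Fin.cases ?_ (fun i => ?_) i
        · rw [Fin.prod_univ_succ] at hw'
          simpa [s] using (eq_inv_of_mul_eq_one_right hw').trans (by simp)
        · simp [s]
      obtain ⟨i, ε⟩ := p
      rw [hw]
      simp [F, signedPerm, h0]
  rw [← Fintype.card_of_bijective hF, Fintype.card_prod, Fintype.card_perm, Fintype.card_fin,
    Fintype.card_fun, Fintype.card_fin, Fintype.card_units_int, mul_comm]

theorem Decomposes.reindex {M ι κ : Type} [AddCommGroup M] [Module ℚ M] [Fintype ι] [Fintype κ]
    {V U : Submodule ℚ M} {c : ι → M →ₗ[ℚ] M} (h : Decomposes V U c) (e : κ ≃ ι) :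
    Decomposes V U (fun k => c (e k)) where
  mem k := h.mem (e k)
  exists_sum g hg := by
    obtain ⟨f, hf, rfl⟩ := h.exists_sum g hg
    exact ⟨fun k => f (e k), fun k => hf _, (e.sum_comp fun i => c i (f i)).symm⟩
  eq_zero f hf h0 k := by
    have := h.eq_zero (fun i => f (e.symm i)) (fun i => hf _) (by
      rw [← e.sum_comp]
      simpa using h0) (e k)
    simpa using this

open LaurentPolynomial in
/-- Every representation of the nilHecke algebra is the direct sum of copies of its common kernel of
the `∂_j`, by means of monomials that are indexed by the Weyl group. -/
theorem exists_decomposes_weylD (N : ℕ) : ∃ w : WeylD (N + 2) → List ℕ,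
    (∑ v, T (2 * ((w v).length : ℤ)) : LaurentPolynomial ℤ) =
      T (((N + 2 : ℕ) : ℤ) * (((N + 2 : ℕ) : ℤ) - 1)) * qInt (N + 2) *
        qDoubleFactorial (N + 2 - 1) ∧
    ∀ (M : Type) [AddCommGroup M] [Module ℚ M] (A : SpinAction N M),
      Decomposes ⊤ (A.inv 0) (fun v => A.word (w v)) := by
  obtain ⟨ι, _, w, hcard, hsum, hdec⟩ := exists_decomposes N (N + 1) le_rfl
  have e : WeylD (N + 2) ≃ ι := Fintype.equivOfCardEq (by rw [hcard, card_weylD])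
  refine ⟨fun v => w (e v), ?_, fun M _ _ A => ?_⟩
  · rw [e.sum_comp fun i => (T (2 * ((w i).length : ℤ)) : LaurentPolynomial ℤ), hsum]
    congr 3
    push_cast
    ring
  · have h := hdec M A
    rw [Nat.sub_self] at h
    exact h.reindex e

/-! ### Endomorphisms as matrices -/

section Matrix

variable {n : ℕ} {ι : Type} [Fintype ι]

/-- The linear combinations of a family of skew polynomials with coefficients in `Λ_{n,ℚ}`. -/
noncomputable def combination (u : ι → PolQ n) : (ι → LamQ n) →ₗ[ℚ] PolQ n :=
  ∑ i, LinearMap.mulLeft ℚ (u i) ∘ₗ (incl n).toLinearMap ∘ₗ LinearMap.proj i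

theorem combination_apply (u : ι → PolQ n) (g : ι → LamQ n) :
    combination u g = ∑ i, u i * incl n (g i) := by
  simp [combination]

/-- A homogeneous basis of the right module of skew polynomials identifies its endomorphisms with
matrices, the column of index `w` holding the coefficients of the image of `u_w`. -/
theorem exists_algEquiv_matrix [DecidableEq ι] {u : ι → PolQ n}
    (hu : Function.Bijective (combination u))
    {e : ι → ℤ} (he : ∀ i, u i ∈ PolQ.degree n (e i))
    (hdeg : ∀ j, ∀ g : ι → LamQ n, combination u g ∈ PolQ.degree n j →
      ∀ i, g i ∈ LamQ.degree n (j - e i)) :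
    ∃ ψ : EndQ n ≃ₐ[ℚ] Matrix ι ι (LamQ n),
      ∀ (k : ℤ) (S : EndQ n), S ∈ EndQ.degree n k ↔ ψ S ∈ matrixDegree e k := by
  let E := LinearEquiv.ofBijective _ hu
  let c := E.symm
  have hc : ∀ f, ∑ i, u i * incl n (c f i) = f := fun f => by
    rw [← combination_apply]
    exact E.apply_symm_apply f
  have hc' : ∀ g, c (∑ i, u i * incl n (g i)) = g := fun g => by
    rw [← combination_apply]
    exact E.symm_apply_apply g
  have hcu : ∀ i, c (u i) = Pi.single i 1 := fun i => by
    rw [← hc' (Pi.single i 1), Finset.sum_eq_single i]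
    · simp
    · intro j _ hj
      simp [hj]
    · simp
  have hT : ∀ (T : EndQ n) f g, T (f * incl n g) = T f * incl n g := fun T f g =>
    T.map_smul (MulOpposite.op g) f
  have hT' : ∀ (T : EndQ n) f, T f = ∑ i, T (u i) * incl n (c f i) := fun T f => by
    conv_lhs => rw [← hc f, map_sum]
    exact Finset.sum_congr rfl fun i _ => hT T _ _
  let F : EndQ n →ₗ[ℚ] Matrix ι ι (LamQ n) :=
    { toFun := fun T => Matrix.of fun v w => c (T (u w)) v
      map_add' := fun S T => by ext v w; simp
      map_smul' := fun a T => by ext v w; simp }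
  have hF : ∀ T v w, F T v w = c (T (u w)) v := fun _ _ _ => rfl
  let Φ : EndQ n →ₐ[ℚ] Matrix ι ι (LamQ n) := AlgHom.ofLinearMap F
    (by
      ext v w
      rw [hF, Module.End.one_apply, hcu, Matrix.one_apply, Pi.single_apply])
    (fun S T => by
      ext v w
      rw [Matrix.mul_apply, hF, Module.End.mul_apply, hT' S (T (u w))]
      have : ∑ i, S (u i) * incl n (c (T (u w)) i) =
          ∑ v, u v * incl n (∑ i, F S v i * F T i w) := by
        simp only [map_sum, Finset.mul_sum]
        rw [Finset.sum_comm]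
        refine Finset.sum_congr rfl fun i _ => ?_
        conv_lhs => rw [← hc (S (u i)), Finset.sum_mul]
        refine Finset.sum_congr rfl fun v _ => ?_
        rw [map_mul, mul_assoc, hF, hF]
      rw [this, hc'])
  have hΦ : Function.Bijective Φ := by
    constructor
    · intro S T h
      refine LinearMap.ext fun f => ?_
      rw [hT' S, hT' T]
      refine Finset.sum_congr rfl fun w _ => ?_
      have : c (S (u w)) = c (T (u w)) := funext fun v => congrFun (congrFun h v) w
      rw [c.injective this]
    · intro A
      let S : EndQ n :=
        { toFun := fun f => ∑ v, u v * incl n (∑ w, A v w * c f w)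
          map_add' := fun f g => by
            simp only [map_add, Pi.add_apply, mul_add, Finset.sum_add_distrib]
          map_smul' := fun g f => by
            induction g using MulOpposite.rec' with
            | _ g =>
              have : c (f * incl n g) = fun w => c f w * g := by
                rw [← hc' fun w => c f w * g]
                conv_lhs => rw [← hc f, Finset.sum_mul]
                simp only [map_mul, mul_assoc]
              simp only [RingHom.id_apply, op_smul_eq, this, Finset.sum_mul, mul_assoc, ← map_mul] }
      refine ⟨S, ?_⟩
      ext v w
      change c (∑ v, u v * incl n (∑ x, A v x * c (u w) x)) v = A v w
      rw [hc', hcu]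
      simp [Pi.single_apply]
  refine ⟨AlgEquiv.ofBijective Φ hΦ, fun k S => ⟨fun hS v w => ?_, fun hS j f hf => ?_⟩⟩
  · have h := hdeg _ (c (S (u w))) (by
      rw [combination_apply, hc]
      exact hS _ _ (he w)) v
    rw [show e w + k - e v = k - (e v - e w) by ring] at h
    exact h
  · rw [hT']
    refine Submodule.sum_mem _ fun w _ => ?_
    have h1 : S (u w) ∈ PolQ.degree n (k + e w) := by
      rw [← hc (S (u w))]
      refine Submodule.sum_mem _ fun v _ => ?_
      have h := PolQ.mul_mem_degree (he v) (hS v w)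
      rw [show e v + (k - (e v - e w)) = k + e w by ring] at h
      exact h
    have h2 : incl n (c f w) ∈ PolQ.degree n (j - e w) :=
      hdeg j (c f) (by rwa [combination_apply, hc]) w
    have h := PolQ.mul_mem_degree h1 h2
    rwa [show k + e w + (j - e w) = j + k by ring] at h

end Matrix

/-! ### The polynomial representation as a graded free module -/

section Free

variable {N : ℕ} {ι : Type} [Fintype ι] {w : ι → List ℕ}

theorem word_incl (l : List ℕ) (g : LamQ (N + 2)) :
    (polAction N).word l 1 * incl _ g = (polAction N).word l (incl _ g) := by
  rw [← polAction_word_mul, one_mul]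

theorem combination_bijective
    (h : Decomposes ⊤ ((polAction N).inv 0) fun i => (polAction N).word (w i)) :
    Function.Bijective (combination fun i => (polAction N).word (w i) 1) := by
  constructor
  · refine (injective_iff_map_eq_zero _).2 fun g hg => funext fun i => ?_
    simp only [combination_apply, word_incl] at hg
    refine incl_injective _ ?_
    rw [Pi.zero_apply, map_zero]
    exact h.eq_zero (fun i => incl _ (g i)) (fun i => mem_inv_iff_exists_incl.2 ⟨_, rfl⟩) hg i
  · intro f
    obtain ⟨m, hm, rfl⟩ := h.exists_sum f trivial
    choose g hg using fun i => mem_inv_iff_exists_incl.1 (hm i)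
    refine ⟨g, ?_⟩
    simp only [combination_apply, ← hg, word_incl]

/-- By uniqueness, the coefficients of a homogeneous skew polynomial are homogeneous. -/
theorem coefficient_mem_degree
    (h : Decomposes ⊤ ((polAction N).inv 0) fun i => (polAction N).word (w i)) {j : ℤ}
    {g : ι → LamQ (N + 2)}
    (hg : combination (fun i => (polAction N).word (w i) 1) g ∈ PolQ.degree (N + 2) j) (i : ι) :
    g i ∈ LamQ.degree (N + 2) (j - 2 * ((w i).length : ℤ)) := by
  have hinv : ∀ i, incl _ (g i) ∈ (polAction N).inv 0 := fun i =>
    mem_inv_iff_exists_incl.2 ⟨_, rfl⟩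
  have hj := componentQ_of_mem hg j
  rw [if_pos rfl] at hj
  simp only [combination_apply, word_incl, map_sum, componentQ_word] at hj
  rw [← sub_eq_zero, ← Finset.sum_sub_distrib] at hj
  simp only [← map_sub] at hj
  have := h.eq_zero _ (fun i => sub_mem (componentQ_mem_inv (hinv i) _) (hinv i)) hj i
  change incl _ (g i) ∈ PolQ.degree _ _
  rw [← sub_eq_zero.1 this]
  exact componentQ_mem _ _

end Free

end SpinNilHeckeD

theorem mainTheorem2 (n : ℕ) (hn : 2 ≤ n) :
    ∃ φ : SpinNilHeckeD.NHQ n ≃ₐ[ℚ] SpinNilHeckeD.EndQ n,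
      (∀ (i : Fin n) (f : SpinNilHeckeD.PolQ n),
        φ (1 ⊗ₜ[ℤ] SpinNilHeckeD.NH.gen (SpinNilHeckeD.Gen.x i)) f =
          (1 ⊗ₜ[ℤ] SpinNilHeckeD.Pol.X i) * f) ∧
      (∀ (i : Fin n) (f : SpinNilHeckeD.PolQ n),
        φ (1 ⊗ₜ[ℤ] SpinNilHeckeD.NH.gen (SpinNilHeckeD.Gen.d i)) f =
          (SpinNilHeckeD.dem i).baseChange ℚ f) ∧
      (∀ (k : ℤ) (a : SpinNilHeckeD.NHQ n),
        a ∈ SpinNilHeckeD.NHQ.degree n k ↔ φ a ∈ SpinNilHeckeD.EndQ.degree n k) ∧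
      ∃ (e : SpinNilHeckeD.WeylD n → ℤ)
        (ψ : SpinNilHeckeD.EndQ n ≃ₐ[ℚ]
          Matrix (SpinNilHeckeD.WeylD n) (SpinNilHeckeD.WeylD n) (SpinNilHeckeD.LamQ n)),
        (∑ w, LaurentPolynomial.T (e w) : LaurentPolynomial ℤ) =
          LaurentPolynomial.T ((n : ℤ) * ((n : ℤ) - 1)) * SpinNilHeckeD.qInt n *
            SpinNilHeckeD.qDoubleFactorial (n - 1) ∧
        ∀ (k : ℤ) (S : SpinNilHeckeD.EndQ n),
          S ∈ SpinNilHeckeD.EndQ.degree n k ↔ ψ S ∈ SpinNilHeckeD.matrixDegree e k := by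
  obtain ⟨N, rfl⟩ : ∃ N, n = N + 2 := ⟨n - 2, by omega⟩
  obtain ⟨w, hsum, hdec⟩ := SpinNilHeckeD.exists_decomposes_weylD N
  have hbij := SpinNilHeckeD.actHom_bijective (hdec _ (SpinNilHeckeD.regAction N))
  have hpol := hdec _ (SpinNilHeckeD.polAction N)
  obtain ⟨ψ, hψ⟩ := SpinNilHeckeD.exists_algEquiv_matrix
    (SpinNilHeckeD.combination_bijective hpol)
    (fun v => SpinNilHeckeD.word_one_mem_degree (w v))
    (fun _ _ hg v => SpinNilHeckeD.coefficient_mem_degree hpol hg v)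
  exact ⟨AlgEquiv.ofBijective (SpinNilHeckeD.actHom N) hbij,
    fun i f => SpinNilHeckeD.polRepQ_x _ i f, fun i f => SpinNilHeckeD.polRepQ_d _ i f,
    SpinNilHeckeD.mem_degree_iff hbij.injective, fun v => 2 * ((w v).length : ℤ), ψ, hsum, hψ⟩
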